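/- **Setting.** An instance $\mathcal I=(G,\Lambda,R,\{W^r\}_{r\in R},\{P^r\}_{r\in R})$ of RWA-P-r consists of a finite directed multigraph $G=(V,E)$ (nodes and links), a finite set $\Lambda$ of wavelengths, and a finite set $R$ of requests; each request $r\in R$ has a source $s^r\in V$, a target $t^r\in V$, and finite collections $W^r$ and $P^r$ of alternative working and protection lightpaths. A lightpath $\ell$ of $r$ is a directed path from $s^r$ to $t^r$ in $G$ together with a wavelength $\Lambda[\ell]\in\Lambda$; $E[\ell]$ is its set of links. Define the conflict sets - $\mathcal C_1=\{(r,w,p): r\in R,\ w\in W^r,\ p\in P^r,\ E[w]\cap E[p]\ne\varnothing\}$, - $\mathcal C_2=\{(r_1,r_2,w,p): r_1\neq r_2,\ w\in W^{r_1},\ p\in P^{r_2},\ \Lambda[w]=\Lambda[p],\ E[w]\cap E[p]\ne\varnothing\}$, - $\mathcal C_3=\{(r_1,r_2,w_1,w_2): r_1\neq r_2,\ w_i\in W^{r_i},\ \Lambda[w_1]=\Lambda[w_2],\ E[w_1]\cap E[w_2]\ne\varnothing\}$, - $\mathcal C_4=\{(r_1,r_2,p_1,p_2): r_1\neq r_2,\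 p_i\in P^{r_i},\ \Lambda[p_1]=\Lambda[p_2],\ E[p_1]\cap E[p_2]\ne\varnothing\}$. A feasible solution consists of $x^r_w,y^r_p\in\{0,1\}$ ($r\in R$, $w\in W^r$, $p\in P^r$) with $\sum_{w\in W^r}x^r_w=\sum_{p\in P^r}y^r_p\le 1$ for every $r\in R$, and with $x^r_w+y^r_p\le1$ on $\mathcal C_1$, $x^{r_1}_w+y^{r_2}_p\le1$ on $\mathcal C_2$, $x^{r_1}_{w_1}+x^{r_2}_{w_2}\le1$ on $\mathcal C_3$, $y^{r_1}_{p_1}+y^{r_2}_{p_2}\le1$ on $\mathcal C_4$. It grants $\sum_{r\in R}\sum_{w\in W^r}x^r_w$ requests. The decision problem Dec-RWA-P-r asks, given an instance $\mathcal I$ and an integer $k\ge 0$, whether some feasible solution grants at least $k$ requests. **Lemma (Verifiability).** Dec-RWA-P-r is in NP. That is, write $\langle\mathcal I,k\rangle$ for the standard encoding of an instance and a number as a string over a finite alphabet (numbers in binary). Then there are a polynomial $p$ and a verifier $V$, computed by a deterministic Turing machine in time polynomial in the total length of its input (the code of an instance, and a certificate), such that for all $(\mathcal I,k)$: some feasible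 solution of $\mathcal I$ grants at least $k$ requests if and only if there is a binary string $c$ of length at most $p(|\langle\mathcal I,k\rangle|)$ with $V(\langle\mathcal I,k\rangle,c)=1$. -/

import Mathlib

open Computability Turing

/-! ### Networks, requests and lightpaths -/

/-- A finite directed multigraph on the nodes `0, …, numNodes - 1`.  A link is identified with its
position in the list `links` of (tail, head) pairs, so parallel links are allowed. -/
structure Network where
  numNodes : ℕ
  links : List (Fin numNodes × Fin numNodes)

namespace Network

variable (G : Network)

abbrev Node : Type := Fin G.numNodes

abbrev Link : Type := Fin G.links.length

def tail (e : G.Link) : G.Node := (G.links.get e).1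

def head (e : G.Link) : G.Node := (G.links.get e).2

/-- `es` is the sequence of links of a directed walk from `u` to `v`. -/
def IsWalk : G.Node → List G.Link → G.Node → Prop
  | u, [], v => u = v
  | u, e :: es, v => G.tail e = u ∧ IsWalk (G.head e) es v

/-- `es` is the sequence of links of a directed path from `u` to `v`: a directed walk that visits
no node twice. -/
def IsPath (u : G.Node) (es : List G.Link) (v : G.Node) : Prop :=
  G.IsWalk u es v ∧ (u :: es.map G.head).Nodup

end Network

/-- A lightpath from `s` to `t`: a directed path together with one of the `m` wavelengths. -/
structure Lightpath (G : Network) (m : ℕ) (s t : G.Node) where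
  wavelength : Fin m
  links : List G.Link
  isPath : G.IsPath s links t

/-- The set of links that a lightpath contains. -/
def Lightpath.linkSet {G : Network} {m : ℕ} {s t : G.Node} (l : Lightpath G m s t) :
    Finset G.Link :=
  l.links.toFinset

/-- A connection request: its source and target nodes and its alternative working and protection
lightpaths. -/
structure Request (G : Network) (m : ℕ) where
  source : G.Node
  target : G.Node
  working : List (Lightpath G m source target)
  protection : List (Lightpath G m source target)

/-! ### The problem of granting as many requests as possible -/

/-- An instance: a network, the number of available wavelengths, and the requests, each with its
alternative working and protection lightpaths. -/
structure Instance where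
  network : Network
  numWavelengths : ℕ
  requests : List (Request network numWavelengths)

namespace Instance

variable (I : Instance)

/-- The set `R` of requests. -/
abbrev R : Type := Fin I.requests.length

def request (r : I.R) : Request I.network I.numWavelengths := I.requests.get r

/-- The set `W^r` of working lightpaths of the request `r`. -/
abbrev W (r : I.R) : Type := Fin (I.request r).working.length

/-- The set `P^r` of protection lightpaths of the request `r`. -/
abbrev P (r : I.R) : Type := Fin (I.request r).protection.length

def workingPath {r : I.R} (w : I.W r) :
    Lightpath I.network I.numWavelengths (I.request r).source (I.request r).target :=
  (I.request r).working.get w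

def protectionPath {r : I.R} (p : I.P r) :
    Lightpath I.network I.numWavelengths (I.request r).source (I.request r).target :=
  (I.request r).protection.get p

/-- A working and a protection lightpath of the same request with a common link. -/
def C₁ : Set (Σ r : I.R, I.W r × I.P r) :=
  {c | ((I.workingPath c.2.1).linkSet ∩ (I.protectionPath c.2.2).linkSet).Nonempty}

/-- A working and a protection lightpath of distinct requests with the same wavelength and a common
link. -/
def C₂ : Set (Σ r : I.R × I.R, I.W r.1 × I.P r.2) :=
  {c | c.1.1 ≠ c.1.2 ∧
    (I.workingPath c.2.1).wavelength = (I.protectionPath c.2.2).wavelength ∧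
    ((I.workingPath c.2.1).linkSet ∩ (I.protectionPath c.2.2).linkSet).Nonempty}

/-- Two working lightpaths of distinct requests with the same wavelength and a common link. -/
def C₃ : Set (Σ r : I.R × I.R, I.W r.1 × I.W r.2) :=
  {c | c.1.1 ≠ c.1.2 ∧
    (I.workingPath c.2.1).wavelength = (I.workingPath c.2.2).wavelength ∧
    ((I.workingPath c.2.1).linkSet ∩ (I.workingPath c.2.2).linkSet).Nonempty}

/-- Two protection lightpaths of distinct requests with the same wavelength and a common link. -/
def C₄ : Set (Σ r : I.R × I.R, I.P r.1 × I.P r.2) :=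
  {c | c.1.1 ≠ c.1.2 ∧
    (I.protectionPath c.2.1).wavelength = (I.protectionPath c.2.2).wavelength ∧
    ((I.protectionPath c.2.1).linkSet ∩ (I.protectionPath c.2.2).linkSet).Nonempty}

/-- Feasibility of the assignment in which `x r w` (resp. `y r p`) indicates whether the working
lightpath `w` (resp. the protection lightpath `p`) is assigned to the request `r`. -/
structure Feasible (x : (r : I.R) → I.W r → ℕ) (y : (r : I.R) → I.P r → ℕ) : Prop where
  balanced : ∀ r, ∑ w, x r w = ∑ p, y r p
  at_most_one : ∀ r, ∑ w, x r w ≤ 1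
  conflict₁ : ∀ r w p, ⟨r, w, p⟩ ∈ I.C₁ → x r w + y r p ≤ 1
  conflict₂ : ∀ r₁ r₂ w p, ⟨(r₁, r₂), w, p⟩ ∈ I.C₂ → x r₁ w + y r₂ p ≤ 1
  conflict₃ : ∀ r₁ r₂ w₁ w₂, ⟨(r₁, r₂), w₁, w₂⟩ ∈ I.C₃ → x r₁ w₁ + x r₂ w₂ ≤ 1
  conflict₄ : ∀ r₁ r₂ p₁ p₂, ⟨(r₁, r₂), p₁, p₂⟩ ∈ I.C₄ → y r₁ p₁ + y r₂ p₂ ≤ 1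
  binary_x : ∀ r w, x r w = 0 ∨ x r w = 1
  binary_y : ∀ r p, y r p = 0 ∨ y r p = 1

/-- The number of granted requests. -/
def granted (x : (r : I.R) → I.W r → ℕ) : ℕ := ∑ r, ∑ w, x r w

/-- The decision problem: can at least `k` requests be granted? -/
def CanGrant (k : ℕ) : Prop :=
  ∃ (x : (r : I.R) → I.W r → ℕ) (y : (r : I.R) → I.P r → ℕ), I.Feasible x y ∧ k ≤ I.granted x

end Instance

/-! ### The encoding of instances as strings

Numbers are written in binary and terminated by a comma, lists are enclosed in brackets. -/

def encNat (n : ℕ) : List Γ' := (encodeNat n).map Γ'.bit ++ [Γ'.comma]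

def encList {α : Type} (f : α → List Γ') (l : List α) : List Γ' :=
  Γ'.bra :: (l.flatMap f ++ [Γ'.ket])

def encNetwork (G : Network) : List Γ' :=
  encNat G.numNodes ++
    encList (fun e : Fin G.numNodes × Fin G.numNodes => encNat e.1.val ++ encNat e.2.val) G.links

def encLightpath {G : Network} {m : ℕ} {s t : G.Node} (l : Lightpath G m s t) : List Γ' :=
  encNat l.wavelength.val ++ encList (fun e : G.Link => encNat e.val) l.links

def encRequest {G : Network} {m : ℕ} (r : Request G m) : List Γ' :=
  encNat r.source.val ++ encNat r.target.val ++ encList encLightpath r.working ++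
    encList encLightpath r.protection

def encInstance (I : Instance) : List Γ' :=
  encNetwork I.network ++ encNat I.numWavelengths ++ encList encRequest I.requests

/-- The code of the question whether at least `k` requests can be granted in `I`. -/
def encQuery (q : Instance × ℕ) : List Γ' := encInstance q.1 ++ encNat q.2

/-! ### The encoding is injective -/

/-- No code word is a proper prefix of another one, and distinct objects have distinct codes. -/
def IsPrefixCode {α : Type} (f : α → List Γ') : Prop :=
  ∀ a b s t, f a ++ s = f b ++ t → a = b ∧ s = t

theorem isPrefixCode_encNat : IsPrefixCode encNat := by
  have key : ∀ (u v : List Bool) (s t : List Γ'),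
      u.map Γ'.bit ++ Γ'.comma :: s = v.map Γ'.bit ++ Γ'.comma :: t → u = v ∧ s = t := by
    intro u
    induction u with
    | nil => intro v s t h; cases v <;> simp_all
    | cons a u ih =>
      intro v s t h
      cases v with
      | nil => simp at h
      | cons b v =>
        simp only [List.map_cons, List.cons_append, List.cons.injEq, Γ'.bit.injEq] at h
        obtain ⟨h1, h2⟩ := ih v s t h.2
        exact ⟨by rw [h.1, h1], h2⟩
  intro a b s t h
  simp only [encNat, List.append_assoc, List.singleton_append] at h
  obtain ⟨h1, h2⟩ := key _ _ _ _ h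
  refine ⟨?_, h2⟩
  rw [← decode_encodeNat a, h1, decode_encodeNat]

theorem encNat_append_ne (n : ℕ) (s t : List Γ') : encNat n ++ s ≠ Γ'.ket :: t := by
  unfold encNat
  cases encodeNat n <;> simp

theorem isPrefixCode_encList {α : Type} {f : α → List Γ'} (hf : IsPrefixCode f)
    (hk : ∀ a s t, f a ++ s ≠ Γ'.ket :: t) : IsPrefixCode (encList f) := by
  intro u
  have key : ∀ v s t, u.flatMap f ++ Γ'.ket :: s = v.flatMap f ++ Γ'.ket :: t → u = v ∧ s = t := by
    induction u with
    | nil =>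
      intro v s t h
      cases v with
      | nil => simpa using h
      | cons b v =>
        simp only [List.flatMap_nil, List.nil_append, List.flatMap_cons, List.append_assoc] at h
        exact absurd h.symm (hk _ _ _)
    | cons a u ih =>
      intro v s t h
      cases v with
      | nil =>
        simp only [List.flatMap_nil, List.nil_append, List.flatMap_cons, List.append_assoc] at h
        exact absurd h (hk _ _ _)
      | cons b v =>
        simp only [List.flatMap_cons, List.append_assoc] at h
        obtain ⟨h1, h2⟩ := hf _ _ _ _ h
        obtain ⟨h3, h4⟩ := ih v s t h2
        exact ⟨by rw [h1, h3], h4⟩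
  intro v s t h
  refine key v s t ?_
  simpa [encList] using h

theorem isPrefixCode_encFin {n : ℕ} : IsPrefixCode (fun e : Fin n => encNat e.val) := by
  intro a b s t h
  obtain ⟨h1, h2⟩ := isPrefixCode_encNat _ _ _ _ h
  exact ⟨Fin.ext h1, h2⟩

theorem isPrefixCode_encNetwork : IsPrefixCode encNetwork := by
  rintro ⟨n, E⟩ ⟨n', E'⟩ s t h
  simp only [encNetwork, List.append_assoc] at h
  obtain ⟨rfl, g1⟩ := isPrefixCode_encNat _ _ _ _ h
  have hp : IsPrefixCode (fun e : Fin n × Fin n => encNat e.1.val ++ encNat e.2.val) := by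
    rintro ⟨a, b⟩ ⟨a', b'⟩ s t h
    simp only [List.append_assoc] at h
    obtain ⟨h1, g2⟩ := isPrefixCode_encFin _ _ _ _ h
    obtain ⟨h2, g3⟩ := isPrefixCode_encFin _ _ _ _ g2
    exact ⟨by rw [h1, h2], g3⟩
  obtain ⟨h1, g4⟩ := isPrefixCode_encList hp
    (fun a s t => by rw [List.append_assoc]; exact encNat_append_ne _ _ _) _ _ _ _ g1
  exact ⟨by rw [h1], g4⟩

theorem isPrefixCode_encLightpath {G : Network} {m : ℕ} {s t : G.Node} :
    IsPrefixCode (encLightpath (G := G) (m := m) (s := s) (t := t)) := by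
  rintro ⟨a, l, _⟩ ⟨a', l', _⟩ u v h
  simp only [encLightpath, List.append_assoc] at h
  obtain ⟨rfl, g1⟩ := isPrefixCode_encFin _ _ _ _ h
  obtain ⟨rfl, g2⟩ := isPrefixCode_encList isPrefixCode_encFin
    (fun _ _ _ => encNat_append_ne _ _ _) _ _ _ _ g1
  exact ⟨rfl, g2⟩

theorem isPrefixCode_encRequest {G : Network} {m : ℕ} :
    IsPrefixCode (encRequest (G := G) (m := m)) := by
  rintro ⟨a, b, w, p⟩ ⟨a', b', w', p'⟩ u v h
  simp only [encRequest, List.append_assoc] at h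
  obtain ⟨rfl, g1⟩ := isPrefixCode_encFin _ _ _ _ h
  obtain ⟨rfl, g2⟩ := isPrefixCode_encFin _ _ _ _ g1
  have hk : ∀ (l : Lightpath G m a b) (s t : List Γ'), encLightpath l ++ s ≠ Γ'.ket :: t := by
    intro l s t
    rw [encLightpath, List.append_assoc]
    exact encNat_append_ne _ _ _
  obtain ⟨rfl, g3⟩ := isPrefixCode_encList isPrefixCode_encLightpath hk _ _ _ _ g2
  obtain ⟨rfl, g4⟩ := isPrefixCode_encList isPrefixCode_encLightpath hk _ _ _ _ g3
  exact ⟨rfl, g4⟩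

theorem isPrefixCode_encInstance : IsPrefixCode encInstance := by
  rintro ⟨G, m, R⟩ ⟨G', m', R'⟩ u v h
  simp only [encInstance, List.append_assoc] at h
  obtain ⟨rfl, g1⟩ := isPrefixCode_encNetwork _ _ _ _ h
  obtain ⟨rfl, g2⟩ := isPrefixCode_encNat _ _ _ _ g1
  obtain ⟨rfl, g3⟩ := isPrefixCode_encList isPrefixCode_encRequest
    (fun r s t => by
      simp only [encRequest, List.append_assoc]
      exact encNat_append_ne _ _ _) _ _ _ _ g2
  exact ⟨rfl, g3⟩

theorem encQuery_injective : Function.Injective encQuery := by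
  rintro ⟨I, k⟩ ⟨I', k'⟩ h
  obtain ⟨rfl, g1⟩ := isPrefixCode_encInstance _ _ _ _ h
  obtain ⟨rfl, _⟩ := isPrefixCode_encNat k k' [] [] (by simpa using g1)
  rfl

/-- The encoding `encQuery`, bundled with the decoding that its injectivity provides. -/
noncomputable def queryEncoding : Encoding (Instance × ℕ) Γ' where
  encode := encQuery
  decode := Function.partialInv encQuery
  decode_encode := Function.partialInv_left encQuery_injective

/-! ### The class NP -/

/-- The decision problem `Q` on instances `α`, written as strings by the encoding `e`, is in NP:
there are a polynomial `p` and a verifier `V`, computed by a Turing machine in time polynomial in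
the length of its input (the code of an instance and a certificate), such that the yes-instances `a`
are exactly those for which `V` accepts some certificate of length at most `p` of the length of the
code of `a`. -/
def InNP {α Γ : Type} (e : Encoding α Γ) (Q : α → Prop) : Prop :=
  ∃ (p : Polynomial ℕ) (V : α × List Bool → Bool),
    Nonempty (TM2ComputableInPolyTime
      (encodingProd e (encodingList Bool)).encode encodingBoolBool.encode V) ∧
    ∀ a, Q a ↔ ∃ c : List Bool, c.length ≤ p.eval (e.encode a).length ∧ V (a, c) = true

/-! A certificate is one bit per lightpath of the instance, saying whether that lightpath is chosen.
Each lightpath has a nonempty code, so the certificate is no longer than the code of the query and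
the polynomial `X` bounds its length (`length_bits_le`). It remains to check in polynomial time, on
an actual stack machine, that the chosen lightpaths are feasible and number at least `k`.

Machine and running time come from a small language of stack programs. A loop consumes a whole
stack, and its body, which cannot touch that stack, adds at most one symbol in total. Hence no loop
increases the total memory, the number of its iterations is at most the memory size, and nested
loops cost a composition of polynomials. `code_simulates` compiles such programs and proves the time
bound once and for all; `exists_computableInPolyTime` packages the result.

The verifier reads the instance once and keeps a log of the wavelengths met, the chosen links, and
the ends of requests. Each chosen link is compared with the whole log: it must not occur in the
current request at all, nor in an earlier request on the same wavelength. A counter started at `k`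
is decremented for every granted request.

Correctness passes through three layers. The stacks are reduced to the abstract memory `Abs`
(`run_scan`, `read_request`, `run_program`). Its evolution is expressed by sets of pairs
(wavelength, link), which yields the condition `Accepts` (`linkConflict_eq`, `request_spec`,
`accepts_iff`). Finally `accepts_choices_iff` identifies `Accepts` with feasibility and the bound on
the granted requests, and `canGrant_iff` translates between certificates and solutions. -/

/-! ### A language of stack programs

Programs over finitely many tapes in which every loop empties a stack that its body does not
touch.  A program is `Bounded` if each iteration of a loop pushes, on balance, at most the symbol
that it consumed; such programs are compiled to Turing machines that run in polynomial time. -/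

/-- Stack programs with tapes `K`, stack symbols `A` and internal states `σ`. -/
inductive StackProg (K A σ : Type) : Type
  | set (f : σ → σ)
  | push (k : K) (a : A)
  | pop (k : K) (c : Option A → StackProg K A σ)
  | seq (c d : StackProg K A σ)
  | choose (f : σ → StackProg K A σ)
  | loop (k : K) (c : A → StackProg K A σ)

namespace StackProg

variable {K A σ : Type}

/-- The program does not use the stack `k`. -/
def Avoids (k : K) : StackProg K A σ → Prop
  | set _ => True
  | push k' _ => k' ≠ k
  | pop k' c => k' ≠ k ∧ ∀ a, (c a).Avoids k
  | seq c d => c.Avoids k ∧ d.Avoids k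
  | choose f => ∀ s, (f s).Avoids k
  | loop k' c => k' ≠ k ∧ ∀ a, (c a).Avoids k

/-- The program increases the total size of the tapes by at most `n`, and loops are well formed. -/
def Bounded : StackProg K A σ → ℕ → Prop
  | set _, _ => True
  | push _ _, n => 1 ≤ n
  | pop _ c, n => (c none).Bounded n ∧ ∀ a, (c (some a)).Bounded (n + 1)
  | seq c d, n => ∃ m ≤ n, c.Bounded m ∧ d.Bounded (n - m)
  | choose f, n => ∀ s, (f s).Bounded n
  | loop k c, _ => ∀ a, (c a).Avoids k ∧ (c a).Bounded 1

/-! ### Semantics of programs and the growth of memory -/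

section Run

variable [DecidableEq K]

/-- The effect of a program on the internal state and the stacks. -/
def run : StackProg K A σ → σ × (K → List A) → σ × (K → List A)
  | set f, x => (f x.1, x.2)
  | push k a, x => (x.1, Function.update x.2 k (a :: x.2 k))
  | pop k c, x => (c (x.2 k).head?).run (x.1, Function.update x.2 k (x.2 k).tail)
  | seq c d, x => d.run (c.run x)
  | choose f, x => (f x.1).run x
  | loop k c, x => (x.2 k).foldl (fun y a => (c a).run y) (x.1, Function.update x.2 k [])

/-- Frame rule: a program that avoids `k` neither reads nor writes it. The semantics of a loop
empties its stack in advance, whereas the machine pops one symbol at a time; this rule reconciles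
the two. -/
theorem run_update {k : K} (l : List A) (c : StackProg K A σ) (hc : c.Avoids k) :
    ∀ s S, c.run (s, Function.update S k l) =
      ((c.run (s, S)).1, Function.update (c.run (s, S)).2 k l) := by
  induction c with
  | set f => intro s S; rfl
  | push k' a =>
    intro s S
    have h : k' ≠ k := hc
    simp only [run, Function.update_of_ne h]
    rw [Function.update_comm h.symm]
  | pop k' c ih =>
    intro s S
    have h : k' ≠ k := hc.1
    simp only [run, Function.update_of_ne h]
    rw [Function.update_comm h.symm, ih _ (hc.2 _)]
  | seq c d ihc ihd =>
    intro s S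
    simp only [run]
    rw [ihc hc.1, ihd hc.2]
  | choose f ih =>
    intro s S
    simp only [run]
    rw [ih _ (hc _)]
  | loop k' c ih =>
    intro s S
    have h : k' ≠ k := hc.1
    simp only [run, Function.update_of_ne h]
    rw [Function.update_comm h.symm]
    generalize S k' = L
    generalize Function.update S k' [] = S'
    induction L generalizing s S' with
    | nil => rfl
    | cons a L ihL =>
      simp only [List.foldl_cons]
      rw [ih a (hc.2 a), ihL]

variable [Fintype K]

/-- The total number of symbols on the stacks. -/
def size (S : K → List A) : ℕ := ∑ k, (S k).length

theorem size_update (S : K → List A) (k : K) (l : List A) :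
    size (Function.update S k l) + (S k).length = size S + l.length := by
  unfold size
  rw [← Finset.add_sum_erase _ _ (Finset.mem_univ k),
    ← Finset.add_sum_erase Finset.univ (fun k => (S k).length) (Finset.mem_univ k)]
  have : ∀ k' ∈ Finset.univ.erase k, (Function.update S k l k').length = (S k').length := by
    intro k' hk'
    rw [Function.update_of_ne (Finset.ne_of_mem_erase hk')]
  rw [Finset.sum_congr rfl this]
  simp only [Function.update_self]
  omega

/-- In a loop the symbol consumed by an iteration pays for the one that the body may add, so even an
unbounded number of iterations does not enlarge the memory. -/
theorem size_run (c : StackProg K A σ) :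
    ∀ n, c.Bounded n → ∀ x, size (c.run x).2 ≤ size x.2 + n := by
  induction c with
  | set f => intro n _ x; simp [run]
  | push k a =>
    intro n h x
    have h : 1 ≤ n := h
    have := size_update x.2 k (a :: x.2 k)
    simp only [List.length_cons] at this
    simp only [run]
    omega
  | pop k c ih =>
    intro n h x
    have hs := size_update x.2 k (x.2 k).tail
    simp only [run]
    rcases hx : x.2 k with _ | ⟨a, l⟩
    · have := ih none n h.1 (x.1, Function.update x.2 k (x.2 k).tail)
      simp only [hx, List.tail_nil, List.length_nil, List.head?_nil] at *
      omega
    · have := ih (some a) _ (h.2 a) (x.1, Function.update x.2 k (x.2 k).tail)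
      simp only [hx, List.tail_cons, List.length_cons, List.head?_cons] at *
      omega
  | seq c d ihc ihd =>
    rintro n ⟨m, hm, hc, hd⟩ x
    have h1 := ihc _ hc x
    have h2 := ihd _ hd (c.run x)
    simp only [run]
    omega
  | choose f ih => intro n h x; exact ih _ _ (h _) x
  | loop k c ih =>
    intro n h x
    have hs := size_update x.2 k []
    simp only [run]
    have key : ∀ (l : List A) (y : σ × (K → List A)),
        size (l.foldl (fun y a => (c a).run y) y).2 ≤ size y.2 + l.length := by
      intro l
      induction l with
      | nil => intro y; simp
      | cons a l ihl =>
        intro y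
        have h1 := ihl ((c a).run y)
        have h2 := ih a 1 (h a).2 y
        simp only [List.foldl_cons, List.length_cons]
        omega
    have := key (x.2 k) (x.1, Function.update x.2 k [])
    simp only [List.length_nil] at *
    omega

end Run

/-! ### Compilation -/

/-- The labels of the machine that executes a program. -/
def Label : StackProg K A σ → Type
  | set _ => Unit
  | push _ _ => Unit
  | pop _ c => Option (Σ a, (c a).Label)
  | seq c d => c.Label ⊕ d.Label
  | choose f => Option (Σ s, (f s).Label)
  | loop _ c => Option (Σ a, (c a).Label)

theorem finite_label [Finite A] [Finite σ] (c : StackProg K A σ) : Finite c.Label := by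
  induction c with
  | set f => exact inferInstanceAs (Finite Unit)
  | push k a => exact inferInstanceAs (Finite Unit)
  | pop k c ih => exact inferInstanceAs (Finite (Option (Σ a, (c a).Label)))
  | seq c d ihc ihd => exact inferInstanceAs (Finite (c.Label ⊕ d.Label))
  | choose f ih => exact inferInstanceAs (Finite (Option (Σ a, (f a).Label)))
  | loop k c ih => exact inferInstanceAs (Finite (Option (Σ a, (c a).Label)))

def entry : (c : StackProg K A σ) → c.Label
  | set _ => ()
  | push _ _ => ()
  | pop _ _ => none
  | seq c _ => Sum.inl c.entry
  | choose _ => none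
  | loop _ _ => none

/-- The stack alphabets: the stacks of the program, and an output stack for one bit. -/
abbrev Alphabet (K A : Type) : Option K → Type
  | none => Bool
  | some _ => A

/-- The code of a program inside a machine with labels `Λ`, which goes on at `e`. -/
def code {Λ : Type} : (c : StackProg K A σ) → (c.Label → Λ) → Λ → c.Label →
    TM2.Stmt (Alphabet K A) Λ (σ × Option A)
  | set f, _, e, _ => .load (fun v => (f v.1, v.2)) (.goto fun _ => e)
  | push k a, _, e, _ => .push (some k) (fun _ => a) (.goto fun _ => e)
  -- The popped symbol is kept in the second component of the internal state, from which the jump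
  -- reads it.
  | pop k c, i, e, l => match l with
    | none => .pop (some k) (fun v a => (v.1, a)) (.goto fun v => i (some ⟨v.2, (c v.2).entry⟩))
    | some l => (c l.1).code (fun l' => i (some ⟨l.1, l'⟩)) e l.2
  | seq c d, i, e, l => match l with
    | .inl l => c.code (fun l' => i (.inl l')) (i (.inr d.entry)) l
    | .inr l => d.code (fun l' => i (.inr l')) e l
  | choose f, i, e, l => match l with
    | none => .goto fun v => i (some ⟨v.1, (f v.1).entry⟩)
    | some l => (f l.1).code (fun l' => i (some ⟨l.1, l'⟩)) e l.2
  | loop k c, i, e, l => match l with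
    | none => .pop (some k) (fun v a => (v.1, a))
        (.goto fun v => v.2.elim e fun a => i (some ⟨a, (c a).entry⟩))
    | some l => (c l.1).code (fun l' => i (some ⟨l.1, l'⟩)) (i none) l.2

/-! ### Simulation of programs by machines in polynomial time -/

section Simulation

variable [DecidableEq K]

/-- The stacks of the machine: those of the program, and an empty output stack. -/
def tapes (S : K → List A) : ∀ k, List (Alphabet K A k)
  | none => []
  | some k => S k

theorem update_tapes (S : K → List A) (k : K) (l : List A) :
    Function.update (tapes S) (some k) l = tapes (Function.update S k l) := by
  funext k'
  cases k' with
  | none => rfl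
  | some k' =>
    by_cases h : k' = k
    · subst h; simp [tapes]
    · rw [Function.update_of_ne (by simpa using h)]
      simp [tapes, Function.update_of_ne h]

/-- The machine gets from one configuration to another one in at most `n` steps. -/
def ReachesIn {Λ : Type} (M : Λ → TM2.Stmt (Alphabet K A) Λ (σ × Option A)) (n : ℕ)
    (x y : TM2.Cfg (Alphabet K A) Λ (σ × Option A)) : Prop :=
  ∃ m ≤ n, (flip bind (TM2.step M))^[m] (some x) = some y

section

variable {Λ : Type} {M : Λ → TM2.Stmt (Alphabet K A) Λ (σ × Option A)}

theorem ReachesIn.mono {m n : ℕ} {x y} (h : ReachesIn M m x y) (hmn : m ≤ n) :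
    ReachesIn M n x y := by
  obtain ⟨i, hi, e⟩ := h
  exact ⟨i, hi.trans hmn, e⟩

theorem ReachesIn.trans {m n : ℕ} {x y z} (h : ReachesIn M m x y) (h' : ReachesIn M n y z) :
    ReachesIn M (m + n) x z := by
  obtain ⟨i, hi, e⟩ := h
  obtain ⟨j, hj, e'⟩ := h'
  refine ⟨j + i, by omega, ?_⟩
  rw [Function.iterate_add_apply, e, e']

theorem ReachesIn.single {l q v S y} (h : M l = q) (h' : TM2.stepAux q v S = y) :
    ReachesIn M 1 ⟨some l, v, S⟩ y :=
  ⟨1, le_rfl, by subst h h'; rfl⟩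

end

theorem eval_mono (P : Polynomial ℕ) {a b : ℕ} (h : a ≤ b) : P.eval a ≤ P.eval b := by
  rw [Polynomial.eval_eq_sum, Polynomial.eval_eq_sum]
  exact Finset.sum_le_sum fun i _ => Nat.mul_le_mul_left _ (Nat.pow_le_pow_left h i)

variable [Fintype K]

/-- The polynomial is chosen before the surrounding machine, so that a subprogram has the same bound
wherever its code is embedded. The saved symbol `o'` is irrelevant afterwards and stays existential.
-/
theorem code_simulates [Fintype A] [Fintype σ] (c : StackProg K A σ) :
    ∀ n, c.Bounded n → ∃ P : Polynomial ℕ, ∀ {Λ : Type}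
      (M : Λ → TM2.Stmt (Alphabet K A) Λ (σ × Option A)) (i : c.Label → Λ) (e : Λ),
      (∀ l, M (i l) = c.code i e l) → ∀ s o S, ∃ o', ReachesIn M (P.eval (size S))
        ⟨some (i c.entry), (s, o), tapes S⟩
        ⟨some e, ((c.run (s, S)).1, o'), tapes (c.run (s, S)).2⟩ := by
  induction c with
  | set f =>
    intro n _
    refine ⟨1, fun M i e hM s o S => ⟨o, ?_⟩⟩
    exact (ReachesIn.single (hM ()) rfl).mono (by simp)
  | push k a =>
    intro n _
    refine ⟨1, fun M i e hM s o S => ⟨o, ?_⟩⟩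
    refine (ReachesIn.single (hM ()) ?_).mono (by simp)
    simp only [run]
    rw [← update_tapes]
    rfl
  | pop k c ih =>
    intro n hb
    have : ∀ a, ∃ n, (c a).Bounded n := fun a => by
      cases a with
      | none => exact ⟨_, hb.1⟩
      | some a => exact ⟨_, hb.2 a⟩
    choose m hm using this
    choose P hP using fun a => ih a _ (hm a)
    refine ⟨1 + ∑ a, P a, fun M i e hM s o S => ?_⟩
    obtain ⟨o', h⟩ := hP (S k).head? M (fun l' => i (some ⟨_, l'⟩)) e
      (fun l => hM (some ⟨_, l⟩)) s (S k).head? (Function.update S k (S k).tail)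
    refine ⟨o', ((ReachesIn.single (hM none) ?_).trans h).mono ?_⟩
    · rw [← update_tapes]
      rfl
    · rw [Polynomial.eval_add, Polynomial.eval_one, Polynomial.eval_finsetSum]
      refine Nat.add_le_add_left (le_trans (eval_mono _ ?_)
        (Finset.single_le_sum (f := fun a => (P a).eval (size S)) (fun _ _ => Nat.zero_le _)
          (Finset.mem_univ (S k).head?))) _
      have := size_update S k (S k).tail
      rw [List.length_tail] at this
      omega
  | seq c d ihc ihd =>
    rintro n ⟨m, hm, hc, hd⟩
    obtain ⟨P, hP⟩ := ihc _ hc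
    obtain ⟨Q, hQ⟩ := ihd _ hd
    -- The second program starts on a memory that has grown by at most `m`.
    refine ⟨P + Q.comp (Polynomial.X + Polynomial.C m), fun M i e hM s o S => ?_⟩
    obtain ⟨o₁, h₁⟩ := hP M (fun l => i (.inl l)) (i (.inr d.entry)) (fun l => hM (.inl l)) s o S
    obtain ⟨o₂, h₂⟩ := hQ M (fun l => i (.inr l)) e (fun l => hM (.inr l))
      (c.run (s, S)).1 o₁ (c.run (s, S)).2
    refine ⟨o₂, (h₁.trans h₂).mono ?_⟩
    rw [Polynomial.eval_add, Polynomial.eval_comp]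
    refine Nat.add_le_add_left (eval_mono _ ?_) _
    simpa using size_run c m hc (s, S)
  | choose f ih =>
    intro n hb
    choose P hP using fun a => ih a _ (hb a)
    refine ⟨1 + ∑ a, P a, fun M i e hM s o S => ?_⟩
    obtain ⟨o', h⟩ := hP s M (fun l' => i (some ⟨_, l'⟩)) e (fun l => hM (some ⟨_, l⟩)) s o S
    refine ⟨o', ((ReachesIn.single (hM none) rfl).trans h).mono ?_⟩
    · rw [Polynomial.eval_add, Polynomial.eval_one, Polynomial.eval_finsetSum]
      exact Nat.add_le_add_left (Finset.single_le_sum (f := fun a => (P a).eval (size S))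
        (fun _ _ => Nat.zero_le _) (Finset.mem_univ s)) _
  | loop k c ih =>
    intro n hb
    choose P hP using fun a => ih a _ (hb a).2
    -- There are at most `X` iterations, each costing one pop and a run of the body. The leading 1
    -- is the pop that finds the stack empty.
    refine ⟨1 + Polynomial.X * (1 + ∑ a, P a), fun M i e hM s o S => ?_⟩
    -- Here `L` is what is left on the loop stack and `S` the memory without it. The bound `N` can
    -- stay fixed along the induction, since an iteration shortens `L` by one and enlarges `S` by at
    -- most one.
    have key : ∀ (L : List A) (N : ℕ) (s : σ) (o : Option A) (S : K → List A), S k = [] →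
        size S + L.length ≤ N → ∃ o', ReachesIn M (1 + L.length * (1 + ∑ a, (P a).eval N))
          ⟨some (i none), (s, o), tapes (Function.update S k L)⟩
          ⟨some e, ((L.foldl (fun y a => (c a).run y) (s, S)).1, o'),
            tapes (L.foldl (fun y a => (c a).run y) (s, S)).2⟩ := by
      intro L
      induction L with
      | nil =>
        intro N s o S hS hN
        refine ⟨none, (ReachesIn.single (hM none) ?_).mono (by simp)⟩
        have e1 : Function.update S k [] = S := by rw [← hS, Function.update_eq_self]
        rw [e1]
        have e2 : (tapes S (some k)).head? = none := by simp [tapes, hS]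
        have e3 : Function.update (tapes S) (some k) (tapes S (some k)).tail = tapes S := by
          rw [update_tapes]
          simp [tapes, hS, e1]
        simp only [code, TM2.stepAux, e2, e3, Option.elim_none, List.foldl_nil]
      | cons a L ihL =>
        intro N s o S hS hN
        obtain ⟨o₁, h₁⟩ := hP a M (fun l => i (some ⟨a, l⟩)) (i none) (fun l => hM (some ⟨a, l⟩))
          s (some a) (Function.update S k L)
        rw [run_update L (c a) (hb a).1] at h₁
        have hk : ((c a).run (s, S)).2 k = [] := by
          have := run_update [] (c a) (hb a).1 s S
          rw [show Function.update S k [] = S by rw [← hS, Function.update_eq_self]] at this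
          rw [this]
          simp
        have hsz := size_run (c a) 1 (hb a).2 (s, S)
        simp only [List.length_cons] at hN
        obtain ⟨o₂, h₂⟩ := ihL N ((c a).run (s, S)).1 o₁ ((c a).run (s, S)).2 hk
          (by simp only at hsz; omega)
        refine ⟨o₂, (((ReachesIn.single (hM none) ?_).trans h₁).trans h₂).mono ?_⟩
        · have e1 : tapes (Function.update S k (a :: L)) (some k) = a :: L := by simp [tapes]
          simp only [code, TM2.stepAux, e1, List.head?_cons, Option.elim_some, List.tail_cons]
          rw [update_tapes, Function.update_idem]
        · have h3 : (P a).eval (size (Function.update S k L)) ≤ ∑ a, (P a).eval N := by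
            refine le_trans (eval_mono _ ?_) (Finset.single_le_sum
              (f := fun a => (P a).eval N) (fun _ _ => Nat.zero_le _) (Finset.mem_univ a))
            have := size_update S k L
            simp only [hS, List.length_nil] at this
            omega
          rw [List.length_cons, Nat.succ_mul]
          omega
    obtain ⟨o', h⟩ := key (S k) (size S) s o (Function.update S k []) (by simp)
      (by have := size_update S k []; simp only [List.length_nil] at this; omega)
    rw [Function.update_idem, Function.update_eq_self] at h
    refine ⟨o', h.mono ?_⟩
    simp only [Polynomial.eval_add, Polynomial.eval_one, Polynomial.eval_mul, Polynomial.eval_X,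
      Polynomial.eval_finsetSum]
    refine Nat.add_le_add_left (Nat.mul_le_mul_right _ ?_) _
    exact Finset.single_le_sum (f := fun k => (S k).length) (fun _ _ => Nat.zero_le _)
      (Finset.mem_univ k)

/-- The machine that executes `c` on the input in the stack `k`, which has to leave all stacks
empty, and outputs the bit `r s` for the final state `s`. -/
noncomputable def machine [Fintype A] [Fintype σ] (c : StackProg K A σ) (k : K) (s₀ : σ)
    (r : σ → Bool) : FinTM2 :=
  haveI := c.finite_label
  haveI : Fintype c.Label := Fintype.ofFinite _
  { K := Option K
    k₀ := some k
    k₁ := none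
    Γ := Alphabet K A
    Λ := Option c.Label
    main := some c.entry
    σ := σ × Option A
    initialState := (s₀, none)
    Γk₀Fin := inferInstanceAs (Fintype A)
    m := fun l => match l with
      | some l => c.code some none l
      -- A halting configuration carries the initial state, so the state is reset after the output.
      | none => .push none (fun v => r v.1) (.load (fun _ => (s₀, none)) .halt) }

/-- Initially the memory size is the input length, so the polynomial of the simulation bounds the
time; one more step outputs the bit. -/
theorem exists_computableInPolyTime [Fintype A] [Fintype σ] (c : StackProg K A σ) {n : ℕ}
    (hc : c.Bounded n) (k : K) (s₀ : σ) (r : σ → Bool) {α : Type} (enc : α → List A)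
    (f : α → Bool)
    (h : ∀ a, ∃ s, c.run (s₀, Function.update (fun _ => []) k (enc a)) = (s, fun _ => []) ∧
      r s = f a) :
    Nonempty (TM2ComputableInPolyTime enc encodingBoolBool.encode f) := by
  obtain ⟨P, hP⟩ := c.code_simulates n hc
  have key : ∀ a, ReachesIn (machine c k s₀ r).m ((P + 1).eval (enc a).length)
      (initList (machine c k s₀ r) (enc a)) (haltList (machine c k s₀ r) [f a]) := by
    intro a
    obtain ⟨s, hs, hr⟩ := h a
    obtain ⟨o', h'⟩ := hP (machine c k s₀ r).m some none (fun l => rfl) s₀ none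
      (Function.update (fun _ => []) k (enc a))
    rw [hs] at h'
    have hsz : size (Function.update (fun _ => []) k (enc a)) = (enc a).length := by
      have := size_update (fun _ => []) k (enc a)
      simpa [size] using this
    rw [hsz] at h'
    rw [Polynomial.eval_add, Polynomial.eval_one]
    have h₂ : ReachesIn (machine c k s₀ r).m 1
        ⟨some none, (s, o'), tapes (fun _ => [])⟩ (haltList (machine c k s₀ r) [f a]) := by
      refine ReachesIn.single (q := .push none (fun v => r v.1)
        (.load (fun _ => (s₀, none)) .halt)) rfl ?_
      simp only [TM2.stepAux, hr]
      unfold haltList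
      congr 1
      funext k'
      cases k' with
      | none => rfl
      | some k' => rfl
    have h₁ : initList (machine c k s₀ r) (enc a) =
        ⟨some (some c.entry), (s₀, none), tapes (Function.update (fun _ => []) k (enc a))⟩ := by
      unfold initList
      congr 1
      funext k'
      cases k' with
      | none => rfl
      | some k' =>
        by_cases hk : k' = k
        · subst hk
          simp only [machine, tapes, Function.update_self]
          exact dif_pos rfl
        · simp [machine, tapes, hk]
    rw [h₁]
    exact h'.trans h₂
  refine ⟨{ tm := machine c k s₀ r
            inputAlphabet := Equiv.refl A
            outputAlphabet := Equiv.refl Bool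
            time := P + 1
            outputsFun := fun a => ?_ }⟩
  have e1 : List.map (Equiv.refl A).invFun (enc a) = enc a := List.map_id _
  exact
    { steps := (key a).choose
      steps_le_m := (key a).choose_spec.1
      evals_in_steps := by
        have := (key a).choose_spec.2
        refine Eq.trans ?_ this
        congr 3 }

end Simulation

end StackProg

/-! ### Evaluation rules; moving and clearing a stack -/

namespace StackProg

theorem bounded_seq {K A σ : Type} {c d : StackProg K A σ} (m : ℕ) {n : ℕ} (hm : m ≤ n)
    (hc : c.Bounded m) (hd : d.Bounded (n - m)) : (c.seq d).Bounded n :=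
  ⟨m, hm, hc, hd⟩

section

variable {K A σ : Type} [DecidableEq K] (x : σ × (K → List A))

theorem run_set (f : σ → σ) : (set f).run x = (f x.1, x.2) := rfl

theorem run_push (k : K) (a : A) :
    (push k a).run x = (x.1, Function.update x.2 k (a :: x.2 k)) := rfl

theorem run_pop (k : K) (c : Option A → StackProg K A σ) : (pop k c).run x =
    (c (x.2 k).head?).run (x.1, Function.update x.2 k (x.2 k).tail) := rfl

theorem run_seq (c d : StackProg K A σ) : (seq c d).run x = d.run (c.run x) := rfl

theorem run_choose (f : σ → StackProg K A σ) : (choose f).run x = (f x.1).run x := rfl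

end

/-- Run `c a` for each symbol `a` of a string. -/
def feed {K A σ : Type} [DecidableEq K] (c : A → StackProg K A σ) (x : σ × (K → List A))
    (l : List A) : σ × (K → List A) :=
  l.foldl (fun y a => (c a).run y) x

section

variable {K A σ : Type} [DecidableEq K] (c : A → StackProg K A σ) (x : σ × (K → List A))

@[simp] theorem feed_nil : feed c x [] = x := rfl

theorem feed_cons (a : A) (l : List A) : feed c x (a :: l) = feed c ((c a).run x) l := rfl

theorem feed_append (l l' : List A) : feed c x (l ++ l') = feed c (feed c x l) l' :=
  List.foldl_append

theorem run_loop (k : K) :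
    (loop k c).run x = feed c (x.1, Function.update x.2 k []) (x.2 k) := rfl

end

/-- Move the symbols of `k` to `k'`, which reverses their order. -/
def move {K A σ : Type} (k k' : K) : StackProg K A σ := loop k fun a => push k' a

theorem bounded_move {K A σ : Type} {k k' : K} (h : k' ≠ k) (n : ℕ) :
    (move k k' : StackProg K A σ).Bounded n :=
  fun _ => ⟨h, le_refl 1⟩

theorem run_move {K A σ : Type} [DecidableEq K] {k k' : K} (h : k' ≠ k) (s : σ)
    (S : K → List A) : (move k k').run (s, S) =
      (s, Function.update (Function.update S k []) k' ((S k).reverse ++ S k')) := by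
  have key : ∀ (l : List A) (S : K → List A),
      l.foldl (fun y a => (push k' a : StackProg K A σ).run y) (s, S) =
        (s, Function.update S k' (l.reverse ++ S k')) := by
    intro l
    induction l with
    | nil => intro S; simp
    | cons a l ih =>
      intro S
      rw [List.foldl_cons, run, ih]
      simp
  rw [move, run, key]
  simp [Function.update_of_ne h]

/-- Empty the stack `k`. -/
def clear {K A σ : Type} (k : K) : StackProg K A σ := loop k fun _ => set id

theorem bounded_clear {K A σ : Type} (k : K) (n : ℕ) :
    (clear k : StackProg K A σ).Bounded n :=
  fun _ => ⟨trivial, trivial⟩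

theorem run_clear {K A σ : Type} [DecidableEq K] (k : K) (s : σ) (S : K → List A) :
    (clear k).run (s, S) = (s, Function.update S k []) := by
  simp only [clear, run]
  generalize Function.update S k [] = S'
  induction S k with
  | nil => rfl
  | cons a l ih => exact ih

end StackProg

/-! ### State and memory of the verifier -/

namespace Verifier

open StackProg

/-- The stacks of the verifier: the instance that remains to be read, a temporary stack, the
certificate, the counter, the strings of granted lightpaths, and the current number, the last three
with a temporary stack each. -/
inductive Tape
  | inp | tmp | cert | num | num' | log | log' | word | word'
  deriving DecidableEq

instance : Fintype Tape where
  elems := {.inp, .tmp, .cert, .num, .num', .log, .log', .word, .word'}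
  complete k := by cases k <;> decide

/-- Input symbols: those of an instance and those of a certificate. -/
abbrev Sym : Type := Γ' ⊕ Bool

/-- What the verifier is reading: the number `k`, the network, the number of wavelengths, the head
of a request, the wavelength of a lightpath, or the links of a lightpath. -/
inductive Mode
  | bound | network | waves | request | wave | links
  deriving DecidableEq

instance : Fintype Mode where
  elems := {.bound, .network, .waves, .request, .wave, .links}
  complete m := by cases m <;> decide

/-- The internal state of the verifier. -/
structure State where
  mode : Mode
  /-- the current list is the one of the protection lightpaths -/
  protection : Bool
  /-- the current lightpath is chosen -/
  chosen : Bool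
  /-- a lightpath in the current list has been chosen -/
  someChosen : Bool
  /-- a working lightpath of the current request has been chosen -/
  granted : Bool
  /-- the solution is infeasible -/
  bad : Bool
  /-- the counter has passed zero -/
  under : Bool
  /-- the number being read agrees with the current one -/
  eq : Bool
  /-- the lightpath being read has the current wavelength -/
  same : Bool
  /-- the current link has been read since the last separator -/
  hit : Bool
  borrow : Bool

noncomputable instance : Fintype State :=
  Fintype.ofInjective
    (fun s => (s.mode, s.protection, s.chosen, s.someChosen, s.granted, s.bad, s.under, s.eq, s.same,
      s.hit, s.borrow))
    (by rintro ⟨⟩ ⟨⟩ h; simpa using h)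

abbrev Prog : Type := StackProg Tape Sym State

/-- The contents of the stacks. -/
structure Mem where
  inp : List Sym := []
  tmp : List Sym := []
  cert : List Sym := []
  num : List Sym := []
  num' : List Sym := []
  log : List Sym := []
  log' : List Sym := []
  word : List Sym := []
  word' : List Sym := []

namespace Mem

def get (S : Mem) : Tape → List Sym
  | .inp => S.inp
  | .tmp => S.tmp
  | .cert => S.cert
  | .num => S.num
  | .num' => S.num'
  | .log => S.log
  | .log' => S.log'
  | .word => S.word
  | .word' => S.word'

variable (S : Mem) (l : List Sym)

@[simp] theorem get_inp : S.get .inp = S.inp := rfl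
@[simp] theorem get_tmp : S.get .tmp = S.tmp := rfl
@[simp] theorem get_cert : S.get .cert = S.cert := rfl
@[simp] theorem get_num : S.get .num = S.num := rfl
@[simp] theorem get_num' : S.get .num' = S.num' := rfl
@[simp] theorem get_log : S.get .log = S.log := rfl
@[simp] theorem get_log' : S.get .log' = S.log' := rfl
@[simp] theorem get_word : S.get .word = S.word := rfl
@[simp] theorem get_word' : S.get .word' = S.word' := rfl

-- These rules turn stack updates into record updates, so that `simp` computes the memory after
-- straight-line code.
@[simp] theorem update_inp : Function.update S.get .inp l = { S with inp := l }.get := by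
  funext k; cases k <;> rfl
@[simp] theorem update_tmp : Function.update S.get .tmp l = { S with tmp := l }.get := by
  funext k; cases k <;> rfl
@[simp] theorem update_cert : Function.update S.get .cert l = { S with cert := l }.get := by
  funext k; cases k <;> rfl
@[simp] theorem update_num : Function.update S.get .num l = { S with num := l }.get := by
  funext k; cases k <;> rfl
@[simp] theorem update_num' : Function.update S.get .num' l = { S with num' := l }.get := by
  funext k; cases k <;> rfl
@[simp] theorem update_log : Function.update S.get .log l = { S with log := l }.get := by
  funext k; cases k <;> rfl
@[simp] theorem update_log' : Function.update S.get .log' l = { S with log' := l }.get := by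
  funext k; cases k <;> rfl
@[simp] theorem update_word : Function.update S.get .word l = { S with word := l }.get := by
  funext k; cases k <;> rfl
@[simp] theorem update_word' : Function.update S.get .word' l = { S with word' := l }.get := by
  funext k; cases k <;> rfl

theorem get_empty : (fun _ => []) = ({} : Mem).get := by
  funext k; cases k <;> rfl

end Mem

/-! ### The program -/

/-- Compare the current number with a number on the log, symbol by symbol; at the end of the latter,
change the state by `g` and replace the terminator as `o` says. -/
def scanSymbol (g : Γ' → State → State) (o : Γ' → State → Γ') : Sym → Prog
  | .inl (.bit x) =>
    seq
      -- If no bit is left, the current number is shorter than the logged one.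
      (pop .word' fun a => a.elim (set fun s => { s with eq := false }) fun y =>
        seq (push .word y) (set fun s => { s with eq := s.eq && decide (y = .inl (.bit x)) }))
      (push .log (.inl (.bit x)))
  | .inl t =>
    seq
      -- A bit left over means that the current number is longer than the logged one; it is put
      -- back.
      (pop .word' fun a => a.elim (set id) fun y =>
        seq (push .word' y) (set fun s => { s with eq := false }))
      (seq (choose fun s => seq (push .log (.inl (o t s))) (set (g t)))
        (seq (move .word .word') (set fun s => { s with eq := true })))
  | .inr _ => set id

/-- Compare the current number with all numbers on the log, and append it to the log. -/
def scan (g : Γ' → State → State) (o : Γ' → State → Γ') : Prog :=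
  -- Moving reverses: the oldest entry and the first bit of the current number come to the top.
  seq (move .log .log') (seq (move .word .word')
    (seq (loop .log' (scanSymbol g o)) (move .word' .log)))

/-- Mark the lightpaths on the log that have the current wavelength. -/
def logWave : Prog :=
  seq (scan (fun _ => id) fun t s =>
      if t = .bra ∨ t = .blank then if s.eq then .bra else .blank else t)
    (push .log (.inl .bra))

/-- The effect on the state of a terminator on the log, while the current number is a link. -/
def linkEffect : Γ' → State → State
  | .bra, s => { s with same := true }
  | .blank, s => { s with same := false }
  | .comma, s => { s with hit := s.hit || s.eq, bad := s.bad || (s.eq && s.same) }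
  -- The end of a request resets `hit`, so after a full scan it refers to the current request alone.
  | .ket, s => { s with hit := false }
  | _, s => s

/-- Look for conflicts between the current link and the links on the log. -/
def logLink : Prog :=
  seq (scan linkEffect fun t _ => t)
    -- Within one request a repeated link is a conflict whatever the wavelengths, as in `C₁`.
    (seq (set fun s => { s with bad := s.bad || s.hit, hit := false, same := false })
      (push .log (.inl .comma)))

/-- Read from the certificate whether the current lightpath is chosen. -/
def readChoice : Prog :=
  pop .cert fun a => set fun s =>
    -- An exhausted certificate counts as an infinite supply of `false`.
    if a = some (.inr true) then
      { s with chosen := true, someChosen := true, bad := s.bad || s.someChosen }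
    else s

def decrementSymbol : Sym → Prog
  | .inl (.bit x) => choose fun s =>
    seq (push .num' (.inl (.bit (x ^^ s.borrow)))) (set fun s => { s with borrow := s.borrow && !x })
  | _ => set id

/-- Decrement the counter. -/
def decrement : Prog :=
  seq (set fun s => { s with borrow := true })
    (seq (loop .num decrementSymbol)
      (seq (move .num' .num)
        (set fun s => { s with under := s.under || s.borrow, borrow := false })))

/-- The end of the list of protection lightpaths of a request. -/
def endRequest : Prog :=
  seq (choose fun s => if s.someChosen then decrement else set id)
    (seq (push .log (.inl .ket))
      (set fun s => { s with
        -- Each list has at most one chosen lightpath unless `bad` is already set, so this tests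
        -- whether the two sums differ.
        bad := s.bad || (s.someChosen ^^ s.granted)
        someChosen := false, granted := false, protection := false, mode := .request }))

/-- Read one symbol of an instance. -/
def readSymbol (s : State) : Sym → Prog
  | .inr _ => set id
  | .inl a => match s.mode with
    | .bound => set id
    -- Numbers of nodes and wavelengths, links of the network, and ends of requests are skipped: the
    -- input is the code of a genuine instance, so nothing has to be validated.
    | .network => if a = .ket then set fun s => { s with mode := .waves } else set id
    | .waves => if a = .bra then set fun s => { s with mode := .request } else set id
    | .request => if a = .bra then set fun s => { s with mode := .wave } else set id
    | .wave => match a with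
      | .bit x => push .word (.inl (.bit x))
      | .comma => seq logWave readChoice
      | .bra => set fun s => { s with mode := .links }
      | .ket => if s.protection then endRequest else
          set fun s => { s with
            granted := s.someChosen, someChosen := false, protection := true, mode := .request }
      | .blank => set id
    | .links => match a with
      | .bit x => push .word (.inl (.bit x))
      | .comma => if s.chosen then logLink else clear .word
      | .ket => set fun s => { s with chosen := false, mode := .wave }
      | _ => set id

/-- Distribute the symbols of the input, read backwards. -/
def splitSymbol (s : State) : Sym → Prog
  | .inr b => push .cert (.inr b)
  | .inl a => match s.mode with
    | .bound => match a with
      | .bit x => push .num (.inl (.bit x))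
      -- Read from the end, the first `ket` closes the list of requests, and only `k` stands behind
      -- it. It is dropped.
      | .ket => set fun s => { s with mode := .network }
      | _ => set id
    | _ => push .inp (.inl a)

/-- The first move lets the input be split from its end, which restores the order of each piece. The
extra decrement at the end turns the test `k ≤ d` for `d` granted requests into an underflow. The
stacks are cleared because the machine has to halt with empty ones. -/
def program : Prog :=
  seq (move .inp .tmp)
    (seq (loop .tmp fun a => choose fun s => splitSymbol s a)
      (seq (loop .inp fun a => choose fun s => readSymbol s a)
        (seq decrement (seq (clear .cert) (seq (clear .num) (clear .log))))))

/-! ### The verifier's program is bounded -/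

theorem bounded_scanSymbol (g o a) : (scanSymbol g o a).Bounded 1 := by
  rcases a with (_ | x | _ | _ | _) | b
  case inl.bit =>
    refine bounded_seq 0 (by simp) ⟨trivial, fun y => ?_⟩ (le_refl 1)
    exact bounded_seq 1 le_rfl (le_refl 1) trivial
  case inr => trivial
  all_goals
    refine bounded_seq 0 (by simp) ⟨trivial, fun y => ?_⟩
      (bounded_seq 1 le_rfl (fun s => ?_) (bounded_seq 0 le_rfl ?_ trivial))
    · exact bounded_seq 1 le_rfl (le_refl 1) trivial
    · exact bounded_seq 1 le_rfl (le_refl 1) trivial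
    · exact bounded_move (by decide) _

theorem avoids_scanSymbol {k : Tape} (hk : k = .log' ∨ k = .inp) (g o a) :
    (scanSymbol g o a).Avoids k := by
  rcases a with (_ | x | _ | _ | _) | b
  case inr => trivial
  all_goals
    rcases hk with rfl | rfl <;>
    · simp only [scanSymbol, Avoids, move, ne_eq, reduceCtorEq, not_false_eq_true, and_self,
        and_true, true_and, implies_true]
      rintro (_ | y) <;> simp [Avoids]

theorem bounded_scan (g o n) : (scan g o).Bounded n :=
  bounded_seq 0 (by simp) (bounded_move (by decide) _) <|
    bounded_seq 0 (by simp) (bounded_move (by decide) _) <|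
      bounded_seq 0 (by simp) (fun _ => ⟨avoids_scanSymbol (.inl rfl) _ _ _, bounded_scanSymbol _ _ _⟩)
        (bounded_move (by decide) _)

theorem bounded_decrement (n) : decrement.Bounded n := by
  refine bounded_seq 0 (by simp) trivial (bounded_seq 0 (by simp) (fun a => ?_)
    (bounded_seq 0 (by simp) (bounded_move (by decide) _) trivial))
  rcases a with (_ | x | _ | _ | _) | b <;>
    simp [decrementSymbol, Avoids, Bounded]
  exact fun _ => ⟨1, le_rfl, le_rfl⟩

/-- A bit is charged when it enters `word`, and its later transfer to the log is free; a terminator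
is charged when it is logged. Thus each input symbol pays for at most one stored symbol. -/
theorem bounded_readSymbol (s a) : (readSymbol s a).Bounded 1 := by
  rcases s with ⟨m, p, c, _⟩
  rcases a with a | b
  · cases m
    case links =>
      cases a <;> cases c
      all_goals first
        | trivial
        | exact le_refl 1
        | exact bounded_clear _ _
        | exact bounded_seq 0 (by simp) (bounded_scan _ _ _)
            (bounded_seq 0 (by simp) trivial (le_refl 1))
    case wave =>
      cases a <;> cases p
      all_goals first
        | trivial
        | exact le_refl 1
        | exact bounded_seq 1 le_rfl (bounded_seq 0 (by simp) (bounded_scan _ _ _) (le_refl 1))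
            ⟨trivial, fun _ => trivial⟩
        | refine bounded_seq 0 (by simp) (fun s => ?_)
            (bounded_seq 1 (by simp) (le_refl 1) trivial)
          dsimp only
          split_ifs
          · exact bounded_decrement _
          · trivial
    all_goals cases a <;> trivial
  · trivial

theorem avoids_readSymbol (s a) : (readSymbol s a).Avoids .inp := by
  have h : ∀ g o, (scan g o).Avoids .inp := by
    intro g o
    exact ⟨⟨by decide, by simp [Avoids]⟩, ⟨by decide, by simp [Avoids]⟩,
      ⟨by decide, avoids_scanSymbol (.inr rfl) g o⟩, by decide, by simp [Avoids]⟩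
  have h' : decrement.Avoids .inp := by
    refine ⟨trivial, ⟨by decide, fun a => ?_⟩, ⟨by decide, by simp [Avoids]⟩, trivial⟩
    rcases a with (_ | x | _ | _ | _) | b <;> simp [decrementSymbol, Avoids]
  rcases s with ⟨m, p, c, _⟩
  rcases a with a | b
  · cases m <;> cases a <;> cases c <;> cases p
    all_goals
      simp [readSymbol, Avoids, logWave, logLink, h, readChoice, endRequest, clear]
    all_goals
      intro s
      split_ifs <;> first | exact h' | trivial
  · trivial

theorem bounded_program : program.Bounded 0 := by
  refine bounded_seq 0 le_rfl (bounded_move (by decide) _) <|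
    bounded_seq 0 le_rfl (fun a => ⟨fun s => ?_, fun s => ?_⟩) <|
    bounded_seq 0 le_rfl (fun a => ⟨fun s => avoids_readSymbol _ _,
      fun s => bounded_readSymbol _ _⟩) <|
    bounded_seq 0 le_rfl (bounded_decrement _) <|
    bounded_seq 0 le_rfl (bounded_clear _ _) <|
    bounded_seq 0 le_rfl (bounded_clear _ _) (bounded_clear _ _)
  all_goals
    rcases s with ⟨m, _⟩
    rcases a with a | b
    · cases m <;> cases a <;> simp [splitSymbol, Avoids, Bounded]
    · simp [splitSymbol, Avoids, Bounded]

end Verifier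

namespace Verifier

open StackProg

/-! ### The effect of the program -/

/-- A binary number. -/
abbrev Word : Type := List Bool

def bits (w : Word) : List Sym := w.map fun b => .inl (.bit b)

@[simp] theorem bits_nil : bits [] = [] := rfl
@[simp] theorem bits_cons (b : Bool) (w : Word) : bits (b :: w) = .inl (.bit b) :: bits w := rfl

/-- The entries of the log: the wavelength of a lightpath, a chosen link, the end of a request. -/
inductive Entry
  | wave (w : Word)
  | link (w : Word)
  | done

namespace Entry

def word : Entry → Word
  | wave w => w
  | link w => w
  | done => []

/-- The terminator of an entry, which for wavelengths tells whether it is the current one. -/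
def terminator (cur : Word) : Entry → Γ'
  | wave w => if w = cur then .bra else .blank
  | link _ => .comma
  | done => .ket

def symbols (cur : Word) (t : Entry) : List Sym := bits t.word ++ [.inl (t.terminator cur)]

theorem terminator_ne_bit (cur : Word) (t : Entry) (b : Bool) : t.terminator cur ≠ .bit b := by
  cases t <;> simp only [terminator] <;> (try split_ifs) <;> simp

end Entry

/-- The symbols of the log, the last one on the top. -/
def logSymbols (cur : Word) (l : List Entry) : List Sym := (l.flatMap (Entry.symbols cur)).reverse

theorem logSymbols_concat (cur : Word) (l : List Entry) (t : Entry) :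
    logSymbols cur (l ++ [t]) =
      .inl (t.terminator cur) :: ((bits t.word).reverse ++ logSymbols cur l) := by
  simp [logSymbols, Entry.symbols]

theorem run_scanSymbol_bits (g o) (w : Word) : ∀ (v : Word) (s : State) (S : Mem),
    S.word' = bits v →
    feed (scanSymbol g o) (s, S.get) (bits w) =
      ({ s with eq := s.eq && w.isPrefixOf v },
        { S with
          word := (bits (v.take w.length)).reverse ++ S.word
          word' := bits (v.drop w.length)
          log := (bits w).reverse ++ S.log }.get) := by
  induction w with
  | nil => intro v s S h; simp [← h]
  | cons b w ih =>
    intro v s S h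
    rw [bits_cons, feed_cons]
    cases v with
    | nil =>
      simp only [scanSymbol, run_set, run_push, run_pop, run_seq, Mem.get_word', h, bits_nil,
        List.head?_nil, Option.elim_none, List.tail_nil, Mem.update_word', Mem.get_log,
        Mem.update_log]
      rw [ih [] _ _ rfl]
      simp
    | cons c v =>
      simp only [scanSymbol, run_set, run_push, run_pop, run_seq, Mem.get_word', h, bits_cons,
        List.head?_cons, Option.elim_some, List.tail_cons, Mem.update_word', Mem.get_log,
        Mem.update_log, Mem.get_word, Mem.update_word]
      rw [ih v _ _ rfl]
      cases b <;> cases c <;> simp [List.isPrefixOf]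

/-- This is the equality test of a scan: no mismatch along `w`, and no bit of `v` left over. -/
theorem isPrefixOf_and_drop (w v : Word) :
    (w.isPrefixOf v = true ∧ v.drop w.length = []) ↔ w = v := by
  rw [List.isPrefixOf_iff_prefix]
  constructor
  · rintro ⟨⟨u, rfl⟩, h⟩
    simp at h
    simp [h]
  · rintro rfl
    simp

theorem run_scanSymbol_entry (g o) (w v : Word) (t : Γ') (ht : ∀ b, t ≠ .bit b) (s : State)
    (S : Mem) (hs : s.eq = true) (h : S.word' = bits v) (h' : S.word = []) :
    feed (scanSymbol g o) (s, S.get) (bits w ++ [.inl t]) =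
      ({ g t { s with eq := decide (w = v) } with eq := true },
        { S with log := Sum.inl (o t { s with eq := decide (w = v) }) ::
            ((bits w).reverse ++ S.log) }.get) := by
  -- At a terminator the bits set aside on `word` return to `word'`, so the current number is whole
  -- again for the next entry.
  have key : ∀ (s : State) (S : Mem),
      (scanSymbol g o (Sum.inl t)).run (s, S.get) =
        ({ g t { s with eq := s.eq && S.word'.isEmpty } with eq := true },
          { S with
            word := [], word' := S.word.reverse ++ S.word'
            log := Sum.inl (o t { s with eq := s.eq && S.word'.isEmpty }) :: S.log }.get) := by
    intro s S
    have e : scanSymbol g o (Sum.inl t) =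
        seq (pop .word' fun a => a.elim (set id) fun y =>
            seq (push .word' y) (set fun s => { s with eq := false }))
          (seq (choose fun s => seq (push .log (.inl (o t s))) (set (g t)))
            (seq (move .word .word') (set fun s => { s with eq := true }))) := by
      cases t with
      | bit b => exact absurd rfl (ht b)
      | _ => rfl
    rw [e]
    have hm : ∀ x : State × (Tape → List Sym), (move .word .word' : Prog).run x =
      (x.1, Function.update (Function.update x.2 .word []) .word'
        ((x.2 .word).reverse ++ x.2 .word')) := fun x => run_move (by decide) _ _
    simp only [run_set, run_push, run_pop, run_seq, run_choose, hm]
    cases hw : S.word' with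
    | nil => simp [run_set, hw]
    | cons y l => simp [run_set, run_push, run_seq, hw]
  rw [feed_append, run_scanSymbol_bits g o w v s S h, feed_cons, feed_nil, key]
  have e : (s.eq && w.isPrefixOf v && (bits (v.drop w.length)).isEmpty) = decide (w = v) := by
    rw [Bool.eq_iff_iff]
    simp only [hs, Bool.true_and, Bool.and_eq_true, decide_eq_true_eq, List.isEmpty_iff, bits,
      List.map_eq_nil_iff]
    exact isPrefixOf_and_drop w v
  have e2 : ((bits (v.take w.length)).reverse ++ S.word).reverse ++ bits (v.drop w.length) =
      S.word' := by
    simp only [h', List.append_nil, List.reverse_reverse, h, bits]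
    rw [← List.map_append, List.take_append_drop]
  simp only [e, e2]
  rw [h']

/-- The effect on the state of the comparison of the number `v` with the log. -/
def scanState (g : Γ' → State → State) (cur v : Word) (s : State) (l : List Entry) : State :=
  l.foldl (fun s t =>
    { g (t.terminator cur) { s with eq := decide (t.word = v) } with eq := true }) s

/-- By `ho`, rewriting the terminators changes the marks from those for the wavelength `cur` to
those for `cur'`. A new wavelength is scanned with `cur' = v`, a link with `cur' = cur`. -/
theorem run_scan (g o) (cur cur' v : Word)
    (ho : ∀ (t : Entry) (s : State), o (Entry.terminator cur t) { s with eq := decide (t.word = v) } =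
      t.terminator cur')
    (l : List Entry) (s : State) (S : Mem) (hs : s.eq = true) (h1 : S.word = (bits v).reverse)
    (h2 : S.word' = []) (h3 : S.log' = []) (h4 : S.log = logSymbols cur l) :
    (scan g o).run (s, S.get) = (scanState g cur v s l,
      { S with word := [], log := (bits v).reverse ++ logSymbols cur' l }.get) := by
  have hm : ∀ x : State × (Tape → List Sym), ∀ k k', k' ≠ k → (move k k' : Prog).run x =
      (x.1, Function.update (Function.update x.2 k []) k' ((x.2 k).reverse ++ x.2 k')) :=
    fun x k k' h => run_move h _ _
  have key : ∀ (l : List Entry) (s : State) (S : Mem), s.eq = true → S.word' = bits v →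
      S.word = [] →
      feed (scanSymbol g o) (s, S.get) (l.flatMap (Entry.symbols cur)) =
        (scanState g cur v s l, { S with log := logSymbols cur' l ++ S.log }.get) := by
    intro l
    induction l with
    | nil => intro s S _ _ _; rfl
    | cons t l ih =>
      intro s S hs h h'
      rw [List.flatMap_cons, feed_append, Entry.symbols]
      rw [run_scanSymbol_entry g o t.word v (t.terminator cur) (t.terminator_ne_bit cur) s S hs h h',
        ho]
      refine (ih { g (t.terminator cur) { s with eq := decide (t.word = v) } with eq := true }
        { S with log := .inl (t.terminator cur') :: ((bits t.word).reverse ++ S.log) }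
        rfl h h').trans ?_
      simp [scanState, logSymbols, Entry.symbols]
  simp only [scan, run_seq, run_loop]
  rw [hm _ _ _ (by decide), hm _ _ _ (by decide), hm _ _ _ (by decide)]
  simp only [Mem.get_log, Mem.update_log, Mem.get_log', Mem.update_log', Mem.get_word,
    Mem.update_word, Mem.get_word', Mem.update_word', h1, h2, h3, h4, logSymbols,
    List.reverse_reverse, List.append_nil]
  rw [key l s _ hs rfl rfl]
  simp [logSymbols]

/-- The effect on the marks `same`, `hit`, `bad` of comparing the link `v` with a log entry. -/
def compareEntry (cur v : Word) (p : Bool × Bool × Bool) : Entry → Bool × Bool × Bool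
  | .wave w => (decide (w = cur), p.2.1, p.2.2)
  | .link w => (p.1, p.2.1 || decide (w = v), p.2.2 || (decide (w = v) && p.1))
  | .done => (p.1, false, p.2.2)

/-- Whether the link `v` on the wavelength `cur` conflicts with a logged one. -/
def linkConflict (cur v : Word) (l : List Entry) : Bool :=
  let p := l.foldl (compareEntry cur v) (false, false, false)
  p.2.2 || p.2.1

/-- The flag `bad` is only ever enlarged by disjunction and influences neither other mark, so its
initial value factors out of the fold. -/
theorem scanState_linkEffect (cur v : Word) (l : List Entry) : ∀ (s : State), s.eq = true →
    scanState linkEffect cur v s l =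
      { s with
        same := (l.foldl (compareEntry cur v) (s.same, s.hit, false)).1
        hit := (l.foldl (compareEntry cur v) (s.same, s.hit, false)).2.1
        bad := s.bad || (l.foldl (compareEntry cur v) (s.same, s.hit, false)).2.2 } := by
  have key : ∀ (s : State), s.eq = true → scanState linkEffect cur v s l =
      { s with
        same := (l.foldl (compareEntry cur v) (s.same, s.hit, s.bad)).1
        hit := (l.foldl (compareEntry cur v) (s.same, s.hit, s.bad)).2.1
        bad := (l.foldl (compareEntry cur v) (s.same, s.hit, s.bad)).2.2 } := by
    induction l with
    | nil => intro s _; rfl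
    | cons t l ih =>
      intro s hs
      rw [scanState, List.foldl_cons, ← scanState, ih _ rfl]
      obtain ⟨m, p, c, sc, gr, ba, un, eq, sa, hi, bo⟩ := s
      simp only at hs
      subst hs
      rcases t with w | w | _
      · by_cases h : w = cur <;> simp [Entry.terminator, linkEffect, compareEntry, h]
      · rfl
      · rfl
  have or_bad : ∀ (l : List Entry) (a b c : Bool),
      l.foldl (compareEntry cur v) (a, b, c) =
        ((l.foldl (compareEntry cur v) (a, b, false)).1,
          (l.foldl (compareEntry cur v) (a, b, false)).2.1,
          c || (l.foldl (compareEntry cur v) (a, b, false)).2.2) := by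
    intro l
    induction l with
    | nil => simp
    | cons t l ih =>
      intro a b c
      rw [List.foldl_cons, List.foldl_cons]
      rcases t with w | w | _ <;> simp only [compareEntry]
      · rw [ih]
      · rw [ih, ih _ _ (false || _)]
        simp [Bool.or_assoc]
      · rw [ih]
  intro s hs
  rw [key s hs, or_bad]

/-- Decrement a binary number, if `c` holds; the second component tells whether it was zero. -/
def decrementBits : Bool → Word → Word × Bool
  | c, [] => ([], c)
  | c, x :: l => ((x ^^ c) :: (decrementBits (c && !x) l).1, (decrementBits (c && !x) l).2)

theorem run_decrement (w : Word) (s : State) (S : Mem) (h : S.num = bits w) (h' : S.num' = []) :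
    decrement.run (s, S.get) =
      ({ s with under := s.under || (decrementBits true w).2, borrow := false },
        { S with num := bits (decrementBits true w).1 }.get) := by
  have key : ∀ (w : Word) (s : State) (S : Mem),
      feed decrementSymbol (s, S.get) (bits w) =
        ({ s with borrow := (decrementBits s.borrow w).2 },
          { S with num' := (bits (decrementBits s.borrow w).1).reverse ++ S.num' }.get) := by
    intro w
    induction w with
    | nil => intro s S; rfl
    | cons x w ih =>
      intro s S
      rw [bits_cons, feed_cons]
      simp only [decrementSymbol, run_set, run_push, run_seq, run_choose, Mem.get_num', Mem.update_num']
      rw [ih]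
      simp [decrementBits]
  have hm : ∀ x : State × (Tape → List Sym), (move .num' .num : Prog).run x =
      (x.1, Function.update (Function.update x.2 .num' []) .num
        ((x.2 .num').reverse ++ x.2 .num)) := fun x => run_move (by decide) _ _
  simp only [decrement, run_set, run_seq, run_loop, Mem.get_num, h, Mem.update_num]
  rw [key, hm]
  simp [h']

/-! ### Reading an instance on an abstract memory -/

/-- A lightpath: its wavelength and its links. -/
abbrev Path : Type := Word × List Word

/-- The relevant part of the memory between two lightpaths. -/
structure Abs where
  cur : Word
  log : List Entry
  cert : List Bool
  num : Word
  someChosen : Bool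
  granted : Bool
  bad : Bool
  under : Bool

namespace Abs

variable (a : Abs)

def state (m : Mode) (p c : Bool) : State where
  mode := m
  protection := p
  chosen := c
  someChosen := a.someChosen
  granted := a.granted
  bad := a.bad
  under := a.under
  eq := true
  same := false
  hit := false
  borrow := false

def mem : Mem where
  cert := a.cert.map Sum.inr
  num := bits a.num
  log := logSymbols a.cur a.log

def config (m : Mode) (p c : Bool) : State × (Tape → List Sym) := (a.state m p c, a.mem.get)

/-- This operation and those up to `request` give the effect of reading one piece of the code, freed
from stacks. The wavelength is logged even if the lightpath turns out not to be chosen. -/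
def wave (w : Word) : Abs :=
  { a with
    cur := w
    log := a.log ++ [.wave w]
    cert := a.cert.tail
    someChosen := a.someChosen || a.cert.headD false
    bad := a.bad || (a.cert.headD false && a.someChosen) }

def link (w : Word) : Abs :=
  { a with
    log := a.log ++ [.link w]
    bad := a.bad || linkConflict a.cur w a.log }

def path (l : Path) : Abs :=
  if a.cert.headD false then l.2.foldl link (a.wave l.1) else a.wave l.1

def endWorking : Abs := { a with granted := a.someChosen, someChosen := false }

def decrement : Abs :=
  { a with
    num := (decrementBits true a.num).1
    under := a.under || (decrementBits true a.num).2 }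

def endRequest : Abs :=
  let b := if a.someChosen then a.decrement else a
  { b with
    log := b.log ++ [.done]
    bad := b.bad || (b.someChosen ^^ b.granted)
    someChosen := false
    granted := false }

def request (r : List Path × List Path) : Abs :=
  (r.2.foldl path (r.1.foldl path a).endWorking).endRequest

/-- Read symbols of an instance. -/
def read (x : State × (Tape → List Sym)) (l : List Sym) : State × (Tape → List Sym) :=
  feed (fun a => choose fun s => readSymbol s a) x l

theorem read_append (x) (l l' : List Sym) : read x (l ++ l') = read (read x l) l' :=
  feed_append _ _ _ _

theorem read_cons (x : State × (Tape → List Sym)) (a : Sym) (l : List Sym) :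
    read x (a :: l) = read ((readSymbol x.1 a).run x) l := rfl

theorem read_nil (x) : read x [] = x := rfl

theorem read_bits (w : Word) : ∀ (s : State) (S : Mem), s.mode = .wave ∨ s.mode = .links →
    read (s, S.get) (bits w) = (s, { S with word := (bits w).reverse ++ S.word }.get) := by
  induction w with
  | nil => intro s S _; rfl
  | cons b w ih =>
    intro s S h
    have e : readSymbol s (.inl (.bit b)) = push .word (.inl (.bit b)) := by
      rcases h with h | h <;> simp [readSymbol, h]
    rw [bits_cons, read_cons]
    simp only [e, run_push, Mem.get_word, Mem.update_word]
    rw [ih _ _ h]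
    simp

theorem read_wave (w : Word) (p : Bool) :
    read (a.config .wave p false) (bits w ++ [.inl .comma, .inl .bra]) =
      (a.wave w).config .links p (a.cert.headD false) := by
  rw [read_append, config, read_bits _ _ _ (.inl rfl)]
  have h : scanState (fun _ => id) a.cur w (a.state .wave p false) a.log =
      a.state .wave p false := by
    have : ∀ l, scanState (fun _ => id) a.cur w (a.state .wave p false) l =
        a.state .wave p false := by
      intro l
      induction l with
      | nil => rfl
      | cons t l ih => exact ih
    exact this _
  have e1 : readSymbol (a.state .wave p false) (.inl .comma) = seq logWave readChoice := rfl
  simp only [read_cons, read_nil, e1, logWave, run_seq]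
  rw [run_scan _ _ a.cur w w ?_ a.log _ _ rfl (by simp [mem]) rfl rfl rfl]
  · rw [h]
    have e : (Entry.wave w).terminator w = .bra := by simp [Entry.terminator]
    have e' := logSymbols_concat w a.log (.wave w)
    rw [e] at e'
    simp only [readChoice, run_set, run_push, run_pop, Mem.get_log, Mem.update_log, Mem.get_cert,
      Mem.update_cert, mem, config, wave, e', state, Entry.word]
    rcases a.cert with _ | ⟨_ | _, c⟩ <;> simp [readSymbol, run_set]
  -- The rewritten marks are those for the new wavelength `w`.
  · intro t s
    rcases t with v | v | _
    · by_cases h1 : v = a.cur <;> by_cases h2 : v = w <;> simp [Entry.terminator, Entry.word, h1, h2]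
    · simp [Entry.terminator]
    · simp [Entry.terminator]

theorem read_link (w : Word) (p : Bool) :
    read (a.config .links p true) (bits w ++ [.inl .comma]) = (a.link w).config .links p true := by
  rw [read_append, config, read_bits _ _ _ (.inr rfl)]
  have e1 : readSymbol (a.state .links p true) (.inl .comma) = logLink := rfl
  simp only [read_cons, read_nil, e1, logLink, run_seq]
  rw [run_scan _ _ a.cur a.cur w ?_ a.log _ _ rfl (by simp [mem]) rfl rfl rfl]
  · rw [scanState_linkEffect _ _ _ _ rfl]
    have e' := logSymbols_concat a.cur a.log (.link w)
    simp only [Entry.terminator, Entry.word] at e'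
    simp [run_set, run_push, config, state, link, mem, e', linkConflict, Bool.or_assoc]
  · intro t s; rfl

theorem read_link_skip (w : Word) (p : Bool) :
    read (a.config .links p false) (bits w ++ [.inl .comma]) = a.config .links p false := by
  rw [read_append, config, read_bits _ _ _ (.inr rfl)]
  have e1 : readSymbol (a.state .links p false) (.inl .comma) = clear .word := rfl
  simp only [read_cons, read_nil, e1]
  simp [run_clear, mem]

def linkSymbols (w : Word) : List Sym := bits w ++ [.inl .comma]

def pathSymbols (l : Path) : List Sym :=
  bits l.1 ++ [.inl .comma, .inl .bra] ++ (l.2.flatMap linkSymbols ++ [.inl .ket])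

theorem read_path (l : Path) (p : Bool) :
    read (a.config .wave p false) (pathSymbols l) = (a.path l).config .wave p false := by
  rw [pathSymbols, read_append, read_wave, read_append,
    path]
  have hk : ∀ (b : Abs) (c : Bool), read (b.config .links p c) [.inl .ket] =
      b.config .wave p false := fun b c => rfl
  split_ifs with h
  · rw [h]
    have : ∀ (ls : List Word) (b : Abs), read (b.config .links p true) (ls.flatMap linkSymbols) =
        (ls.foldl link b).config .links p true := by
      intro ls
      induction ls with
      | nil => intro b; rfl
      | cons w ls ih =>
        intro b
        rw [List.flatMap_cons, read_append, linkSymbols, read_link, ih]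
        rfl
    rw [this]
    exact hk _ _
  · rw [Bool.not_eq_true] at h
    rw [h]
    have : ∀ (ls : List Word) (b : Abs), read (b.config .links p false) (ls.flatMap linkSymbols) =
        b.config .links p false := by
      intro ls
      induction ls with
      | nil => intro b; rfl
      | cons w ls ih =>
        intro b
        rw [List.flatMap_cons, read_append, linkSymbols,
          read_link_skip, ih]
    rw [this]
    exact hk _ _

theorem read_paths (p : Bool) (ls : List Path) : ∀ a : Abs,
    read (a.config .wave p false) (ls.flatMap pathSymbols) =
      (ls.foldl path a).config .wave p false := by
  induction ls with
  | nil => intro a; rfl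
  | cons l ls ih =>
    intro a
    rw [List.flatMap_cons, read_append, read_path, ih]
    rfl

theorem read_endRequest :
    read (a.config .wave true false) [.inl .ket] = a.endRequest.config .request false false := by
  have e1 : readSymbol (a.state .wave true false) (.inl .ket) = Verifier.endRequest := rfl
  have e' := logSymbols_concat a.cur a.log .done
  simp only [Entry.terminator, Entry.word] at e'
  simp only [read_cons, read_nil, config, e1, Verifier.endRequest, run_set, run_push, run_seq,
    run_choose]
  cases h : a.someChosen
  · simp [run_set, mem, endRequest, h, e', state]
  · have e2 : (a.state .wave true false).someChosen = true := h
    rw [if_pos e2, run_decrement a.num _ _ rfl rfl]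
    simp [mem, endRequest, h, e', decrement, state]

/-- The symbols of a request; those before the first list do not matter. -/
theorem read_request (u : List Sym) (hu : .inl .bra ∉ u) (r : List Path × List Path) :
    read (a.config .request false false) (u ++ .inl .bra :: (r.1.flatMap pathSymbols ++
      [.inl .ket, .inl .bra] ++ (r.2.flatMap pathSymbols ++ [.inl .ket]))) =
      (a.request r).config .request false false := by
  have hu' : read (a.config .request false false) u = a.config .request false false := by
    induction u with
    | nil => rfl
    | cons x u ih =>
      simp only [List.mem_cons, not_or] at hu
      have : readSymbol (a.state .request false false) x = set id := by
        rcases x with x | x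
        · have : x ≠ .bra := fun h => hu.1 (by rw [h])
          simp [readSymbol, state, this]
        · rfl
      rw [read_cons, config, this]
      exact ih hu.2
  have e1 : (readSymbol (a.config .request false false).1 (.inl .bra)).run
    (a.config .request false false) = a.config .wave false false := rfl
  have e2 : ∀ a : Abs, read (a.config .wave false false) [.inl .ket, .inl .bra] =
    a.endWorking.config .wave true false := fun a => rfl
  rw [read_append, hu', read_cons, e1, read_append, read_append, read_append, read_paths, e2,
    read_paths, read_endRequest]
  rfl

end Abs

end Verifier

namespace Verifier

/-! ### What the verifier checks -/

/-- A link on a wavelength. -/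
abbrev Item : Type := Option Word × Word

/-- The wavelength of the last lightpath on the log, the links of the completed requests, and those
of the current request. -/
def view (l : List Entry) : Option Word × List Item × List Item :=
  l.foldl (fun v t => match t with
    | .wave w => (some w, v.2)
    | .link w => (v.1, v.2.1, v.2.2 ++ [(v.1, w)])
    | .done => (v.1, v.2.1 ++ v.2.2, [])) (none, [], [])

theorem view_wave (l : List Entry) (w : Word) : view (l ++ [.wave w]) = (some w, (view l).2) := by
  simp [view]

theorem view_link (l : List Entry) (w : Word) : view (l ++ [.link w]) =
    ((view l).1, (view l).2.1, (view l).2.2 ++ [((view l).1, w)]) := by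
  simp [view]

theorem view_done (l : List Entry) : view (l ++ [.done]) =
    ((view l).1, (view l).2.1 ++ (view l).2.2, []) := by
  simp [view]

/-- After a scan the three marks tell whether the last wavelength is `cur`, whether `v` occurs in
the current request, and whether `(cur, v)` occurs anywhere. An occurrence of `(cur, v)` in the
current request is subsumed by the second mark. -/
theorem linkConflict_eq (cur v : Word) (l : List Entry) : linkConflict cur v l =
    decide ((some cur, v) ∈ (view l).2.1 ∨ v ∈ (view l).2.2.map Prod.snd) := by
  have key : l.foldl (compareEntry cur v) (false, false, false) =
      (decide ((view l).1 = some cur), decide (v ∈ (view l).2.2.map Prod.snd),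
        decide ((some cur, v) ∈ (view l).2.1 ++ (view l).2.2)) := by
    induction l using List.reverseRecOn with
    | nil => rfl
    | append_singleton l t ih =>
      rw [List.foldl_append, ih]
      rcases t with w | w | _
      · simp [view_wave, compareEntry]
      · simp only [List.foldl_cons, List.foldl_nil, compareEntry, view_link]
        refine Prod.ext rfl (Prod.ext ?_ ?_)
        · rw [Bool.eq_iff_iff]
          simp [eq_comm (a := w)]
        · rw [Bool.eq_iff_iff]
          simp [eq_comm (a := w), eq_comm (a := (view l).1), or_assoc, and_comm (a := v = w)]
      · simp [view_done, compareEntry]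
  rw [linkConflict, key, Bool.eq_iff_iff]
  simp only [Bool.or_eq_true, decide_eq_true_eq, List.mem_append]
  constructor
  · rintro ((h | h) | h)
    · exact .inl h
    · exact .inr (List.mem_map_of_mem (f := Prod.snd) h)
    · exact .inr h
  · rintro (h | h)
    · exact .inl (.inl h)
    · exact .inr h

/-- The links in `l` conflict neither with each other, nor with earlier ones of the same request, nor
with those of other requests. -/
def NoConflict (past curr l : List Item) : Prop :=
  (∀ i ∈ l, i ∉ past) ∧ (∀ i ∈ l, i.2 ∉ curr.map Prod.snd) ∧ (l.map Prod.snd).Nodup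

theorem noConflict_nil (past curr : List Item) : NoConflict past curr [] := by
  simp [NoConflict]

/-- This makes the check of one link at a time equivalent to a condition on the whole list of chosen
links. -/
theorem noConflict_append (past curr l l' : List Item) :
    NoConflict past curr (l ++ l') ↔ NoConflict past curr l ∧ NoConflict past (curr ++ l) l' := by
  simp only [NoConflict, List.mem_append, List.map_append, List.nodup_append, not_or]
  constructor
  · rintro ⟨h1, h2, h3, h4, h5⟩
    exact ⟨⟨fun i hi => h1 i (.inl hi), fun i hi => h2 i (.inl hi), h3⟩,
      fun i hi => h1 i (.inr hi), fun i hi => ⟨h2 i (.inr hi), fun h =>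
        h5 _ h _ (List.mem_map_of_mem (f := Prod.snd) hi) rfl⟩, h4⟩
  · rintro ⟨⟨h1, h2, h3⟩, h4, h5, h6⟩
    refine ⟨fun i hi => hi.elim (h1 i) (h4 i), fun i hi => hi.elim (h2 i) fun h => (h5 i h).1,
      h3, h6, ?_⟩
    rintro x hx y hy rfl
    obtain ⟨i, hi, rfl⟩ := List.mem_map.1 hy
    exact (h5 i hi).2 hx

/-- The links of the chosen lightpaths in a list. -/
def chosenItems (l : List (Path × Bool)) : List Item :=
  l.flatMap fun q => if q.2 then q.1.2.map fun w => (some q.1.1, w) else []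

/-- Attach to each lightpath a bit of the certificate. -/
def annotate : List Path → List Bool → List (Path × Bool)
  | [], _ => []
  | l :: ls, c => (l, c.headD false) :: annotate ls c.tail

namespace Abs

theorem foldl_link (ls : List Word) : ∀ a : Abs, (view a.log).1 = some a.cur →
    ∃ l b, ls.foldl link a = { a with log := l, bad := b } ∧
      (view l).2 = ((view a.log).2.1, (view a.log).2.2 ++ ls.map fun w => (some a.cur, w)) ∧
      (b = false ↔ a.bad = false ∧
        NoConflict (view a.log).2.1 (view a.log).2.2 (ls.map fun w => (some a.cur, w))) := by
  induction ls with
  | nil => intro a _; exact ⟨a.log, a.bad, rfl, by simp, by simp [noConflict_nil]⟩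
  | cons w ls ih =>
    intro a ha
    obtain ⟨l, b, h1, h2, h3⟩ := ih (a.link w) (by simp [link, view_link, ha])
    refine ⟨l, b, h1, ?_, ?_⟩
    · rw [h2]
      simp [link, view_link, ha]
    · rw [h3, List.map_cons, ← List.singleton_append, noConflict_append, ← and_assoc]
      simp only [link, view_link, ha, linkConflict_eq]
      refine and_congr_left fun _ => ?_
      simp [NoConflict]

/-- Later checks depend on the log only through its `view`, so the log itself stays existential. The
summand `a.someChosen.toNat` accounts for a lightpath chosen earlier in the same list. -/
theorem foldl_path (ls : List Path) : ∀ a : Abs,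
    ∃ cur l b, ls.foldl path a = { a with
        cur := cur
        log := l
        bad := b
        cert := a.cert.drop ls.length
        someChosen := a.someChosen || (annotate ls a.cert).any Prod.snd } ∧
      (view l).2 = ((view a.log).2.1, (view a.log).2.2 ++ chosenItems (annotate ls a.cert)) ∧
      (b = false ↔ a.bad = false ∧
        (annotate ls a.cert).countP Prod.snd + a.someChosen.toNat ≤ 1 ∧
        NoConflict (view a.log).2.1 (view a.log).2.2 (chosenItems (annotate ls a.cert))) := by
  induction ls with
  | nil =>
    intro a
    refine ⟨a.cur, a.log, a.bad, ?_, by simp [annotate, chosenItems], ?_⟩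
    · simp [annotate]
    · have := Bool.toNat_le a.someChosen
      simp [annotate, chosenItems, noConflict_nil, this]
  | cons p ls ih =>
    intro a
    have hv : (view (a.wave p.1).log) = (some p.1, (view a.log).2) := view_wave _ _
    obtain ⟨l', b', h1', h2', h3'⟩ := foldl_link p.2 (a.wave p.1) (by rw [hv]; rfl)
    rw [hv] at h2' h3'
    simp only at h2' h3'
    obtain ⟨cur, l, b, h1, h2, h3⟩ := ih (a.path p)
    refine ⟨cur, l, b, ?_, ?_, ?_⟩
    · rw [List.foldl_cons, h1, path]
      split_ifs with h <;> rw [List.headD_eq_head?_getD] at h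
      · rw [h1']
        simp [wave, annotate, Bool.or_assoc]
      · simp [wave, annotate, Bool.or_assoc]
    · rw [h2, path]
      split_ifs with h <;> rw [List.headD_eq_head?_getD] at h
      · rw [h1', h2']
        simp [wave, annotate, chosenItems, h]
      · rw [hv]
        simp [wave, annotate, chosenItems, h]
    · rw [h3, path]
      split_ifs with h <;> rw [List.headD_eq_head?_getD] at h
      · rw [h1', h2']
        simp only [h3']
        simp only [wave, annotate, chosenItems, List.headD_eq_head?_getD, h, List.countP_cons, List.flatMap_cons,
          noConflict_append, if_true]
        cases a.someChosen <;> simp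
        tauto
      · rw [Bool.not_eq_true] at h
        rw [hv]
        simp [wave, annotate, chosenItems, h]

end Abs

/-- A request with its lightpaths annotated. -/
abbrev Choice : Type := List (Path × Bool) × List (Path × Bool)

def annotateRequests : List (List Path × List Path) → List Bool → List Choice
  | [], _ => []
  | r :: rs, c => (annotate r.1 c, annotate r.2 (c.drop r.1.length)) ::
      annotateRequests rs ((c.drop r.1.length).drop r.2.length)

namespace Choice

def items (r : Choice) : List Item := chosenItems r.1 ++ chosenItems r.2

/-- The constraints that concern a single request. -/
def Valid (r : Choice) : Prop :=
  r.1.countP Prod.snd = r.2.countP Prod.snd ∧ r.1.countP Prod.snd ≤ 1 ∧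
    (r.items.map Prod.snd).Nodup

def granted (r : Choice) : Bool := r.2.any Prod.snd

end Choice

theorem toNat_any (l : List (Path × Bool)) (h : l.countP Prod.snd ≤ 1) :
    (l.any Prod.snd).toNat = l.countP Prod.snd := by
  cases h' : l.any Prod.snd
  · have : l.countP Prod.snd = 0 := by
      rw [List.countP_eq_zero]
      simpa using h'
    simp [this]
  · have : 0 < l.countP Prod.snd := by
      rw [List.countP_pos_iff]
      simpa using h'
    simp only [Bool.toNat_true]
    omega

/-! ### The counter and the final verdict -/

/-- The value of a binary number. -/
def value : Word → ℕ
  | [] => 0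
  | b :: w => b.toNat + 2 * value w

theorem value_decrementBits (w : Word) : ∀ c, 
    if (decrementBits c w).2 then value w = 0 ∧ c = true
    else value (decrementBits c w).1 + c.toNat = value w := by
  induction w with
  | nil => intro c; cases c <;> simp [decrementBits, value]
  | cons x w ih =>
    intro c
    have := ih (c && !x)
    simp only [decrementBits, value]
    cases c <;> cases x <;> simp only [Bool.not_true, Bool.not_false, Bool.and_true,
      Bool.and_false, Bool.toNat_true, Bool.toNat_false, Bool.xor_true, Bool.xor_false,
      ] at this ⊢ <;> split_ifs at this ⊢ <;>
      first
        | omega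
        | (refine ⟨?_, trivial⟩; omega)
        | simp at this

theorem value_encodeNat (n : ℕ) : value (encodeNat n) = n := by
  have h : ∀ p : PosNum, value (encodePosNum p) = (p : ℕ) := by
    intro p
    induction p with
    | one => rfl
    | bit0 p ih =>
      simp only [encodePosNum, value, ih, PosNum.cast_bit0, Bool.toNat_false]
      omega
    | bit1 p ih =>
      simp only [encodePosNum, value, ih, PosNum.cast_bit1, Bool.toNat_true]
      omega
  unfold encodeNat
  conv_rhs => rw [← Num.to_of_nat n]
  cases (n : Num) with
  | zero => rfl
  | pos p => exact h p

namespace Abs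

/-- The counter was `k`, and has been decremented `d` times. -/
def Counts (a : Abs) (k d : ℕ) : Prop :=
  (a.under = true → k < d) ∧ (a.under = false → value a.num + d = k)

/-- The first underflow happens at value 0, when `k = d`. Afterwards the stored number is
meaningless, but `under` is never reset. -/
theorem counts_decrement {a : Abs} {k d : ℕ} (h : a.Counts k d) :
    a.decrement.Counts k (d + 1) := by
  have := value_decrementBits a.num true
  obtain ⟨h1, h2⟩ := h
  constructor
  · intro hu
    rcases Bool.or_eq_true_iff.1 hu with hu | hu
    · exact (h1 hu).trans (Nat.lt_succ_self d)
    · rw [if_pos hu] at this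
      cases hu' : a.under
      · have := h2 hu'
        omega
      · exact (h1 hu').trans (Nat.lt_succ_self d)
  · intro hu
    obtain ⟨hu, hu'⟩ := Bool.or_eq_false_iff.1 hu
    rw [if_neg (by simp [hu'])] at this
    have := h2 hu
    simp only [decrement, Bool.toNat_true] at *
    omega

/-- The conditions from the two lists merge by `noConflict_append`, the links of the working list
being the current ones when the protection list is read. The hypotheses `hs` and `hc` say that
nothing is left over from the previous request. -/
theorem request_spec (a : Abs) (r : List Path × List Path) (hs : a.someChosen = false)
    (hc : (view a.log).2.2 = []) (q : Choice)
    (hq : q = (annotate r.1 a.cert, annotate r.2 (a.cert.drop r.1.length))) :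
    (a.request r).someChosen = false ∧ (view (a.request r).log).2.2 = [] ∧
      (view (a.request r).log).2.1 = (view a.log).2.1 ++ q.items ∧
      (a.request r).cert = (a.cert.drop r.1.length).drop r.2.length ∧
      ((a.request r).bad = false ↔ a.bad = false ∧ q.Valid ∧
        ∀ i ∈ q.items, i ∉ (view a.log).2.1) ∧
      ∀ k d, a.Counts k d → (a.request r).Counts k (d + q.granted.toNat) := by
  obtain ⟨cur, l, b, h1, h2, h3⟩ := foldl_path r.1 a
  obtain ⟨cur', l', b', h1', h2', h3'⟩ := foldl_path r.2 (r.1.foldl path a).endWorking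
  rw [request, h1']
  rw [h1] at h2' h3' ⊢
  simp only [endWorking, h2, hc, hs, List.nil_append, Bool.toNat_false, Nat.add_zero,
    Bool.false_or] at h2' h3' h3 ⊢
  rw [h3] at h3'
  subst hq
  have hview : view (l' ++ [.done]) = ((view l').1, (view l').2.1 ++ (view l').2.2, []) :=
    view_done _
  have hbad : (b' || ((annotate r.2 (a.cert.drop r.1.length)).any Prod.snd ^^
      (annotate r.1 a.cert).any Prod.snd)) = false ↔ a.bad = false ∧
      Choice.Valid (annotate r.1 a.cert, annotate r.2 (a.cert.drop r.1.length)) ∧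
        ∀ i ∈ Choice.items (annotate r.1 a.cert, annotate r.2 (a.cert.drop r.1.length)),
          i ∉ (view a.log).2.1 := by
    rw [Bool.or_eq_false_iff, h3']
    have e : ∀ x, NoConflict (view a.log).2.1 [] x ↔
      (∀ i ∈ x, i ∉ (view a.log).2.1) ∧ (x.map Prod.snd).Nodup := fun x => by simp [NoConflict]
    have e' := noConflict_append (view a.log).2.1 [] (chosenItems (annotate r.1 a.cert))
      (chosenItems (annotate r.2 (a.cert.drop r.1.length)))
    rw [List.nil_append, e] at e'
    simp only [Choice.Valid, Choice.items]
    generalize annotate r.1 a.cert = ws at *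
    generalize annotate r.2 (a.cert.drop r.1.length) = ps at *
    have hcount : ws.countP Prod.snd ≤ 1 → ps.countP Prod.snd ≤ 1 →
        ((ps.any Prod.snd ^^ ws.any Prod.snd) = false ↔
          ws.countP Prod.snd = ps.countP Prod.snd) := by
      intro hw hp
      rw [← toNat_any _ hw, ← toNat_any _ hp]
      cases ws.any Prod.snd <;> cases ps.any Prod.snd <;> simp
    constructor
    · rintro ⟨⟨⟨h1, h2, h3⟩, h4, h5⟩, h6⟩
      have := e'.2 ⟨h3, h5⟩
      exact ⟨h1, ⟨(hcount h2 h4).1 h6, h2, this.2⟩, this.1⟩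
    · rintro ⟨h1, ⟨h2, h3, h4⟩, h5⟩
      have := e'.1 ⟨h5, h4⟩
      exact ⟨⟨⟨h1, h3, this.1⟩, h2 ▸ h3, this.2⟩, (hcount h3 (h2 ▸ h3)).2 h2⟩
  cases hg : (annotate r.2 (a.cert.drop r.1.length)).any Prod.snd
  · rw [hg] at hbad
    simp only [endRequest, hg, hview, h2', Choice.granted, Choice.items, decrement,
      Bool.false_eq_true, if_false, true_and]
    refine ⟨hbad, fun k d h => ?_⟩
    simpa [Counts] using h
  · rw [hg] at hbad
    simp only [endRequest, hg, hview, h2', Choice.granted, Choice.items, decrement,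
      if_true, true_and]
    refine ⟨hbad, fun k d h => ?_⟩
    exact counts_decrement h

/-- Each request is compared only with what precedes it. The log at the start is arbitrary, so that
in the induction the items of the first request can join the past ones. -/
theorem foldl_request (rs : List (List Path × List Path)) : ∀ (a : Abs), a.someChosen = false →
    (view a.log).2.2 = [] → ∀ k d, a.Counts k d →
    ((rs.foldl request a).bad = false ↔ a.bad = false ∧
      (∀ q ∈ annotateRequests rs a.cert, q.Valid) ∧
      (∀ q ∈ annotateRequests rs a.cert, ∀ i ∈ q.items, i ∉ (view a.log).2.1) ∧
      (annotateRequests rs a.cert).Pairwise fun q q' => ∀ i ∈ q'.items, i ∉ q.items) ∧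
    (rs.foldl request a).Counts k
      (d + (annotateRequests rs a.cert).countP Choice.granted) := by
  induction rs with
  | nil => intro a _ _ k d h; simpa [annotateRequests] using h
  | cons r rs ih =>
    intro a hs hc k d h
    obtain ⟨h1, h2, h3, h4, h5, h6⟩ := request_spec a r hs hc _ rfl
    obtain ⟨h7, h8⟩ := ih (a.request r) h1 h2 k _ (h6 k d h)
    rw [List.foldl_cons, h7, h5, h4, annotateRequests, h3]
    rw [h4] at h8
    refine ⟨?_, ?_⟩
    · simp only [List.forall_mem_cons, List.pairwise_cons, List.mem_append, not_or]
      constructor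
      · rintro ⟨⟨h1, h2, h3⟩, h4, h5, h6⟩
        exact ⟨h1, ⟨h2, h4⟩, ⟨h3, fun q hq i hi => (h5 q hq i hi).1⟩,
          fun q hq i hi => (h5 q hq i hi).2, h6⟩
      · rintro ⟨h1, ⟨h2, h4⟩, ⟨h3, h5⟩, h7, h6⟩
        exact ⟨⟨h1, h2, h3⟩, h4, fun q hq i hi => ⟨h5 q hq i hi, h7 q hq i hi⟩, h6⟩
    · rw [List.countP_cons]
      convert h8 using 1
      generalize annotateRequests rs _ = qs
      cases Choice.granted _ <;> simp
      omega

/-- The memory after the input has been split. -/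
def init (k : ℕ) (c : List Bool) : Abs where
  cur := []
  log := []
  cert := c
  num := encodeNat k
  someChosen := false
  granted := false
  bad := false
  under := false

end Abs

/-- The chosen lightpaths form a feasible solution that grants at least `k` requests. -/
def Accepts (qs : List Choice) (k : ℕ) : Prop :=
  (∀ q ∈ qs, q.Valid) ∧ (qs.Pairwise fun q q' => ∀ i ∈ q'.items, i ∉ q.items) ∧
    k ≤ qs.countP Choice.granted

/-- With the extra decrement the counter underflows exactly when `k < d + 1`, where `d` is the
number of granted requests. -/
theorem accepts_iff (rs : List (List Path × List Path)) (k : ℕ) (c : List Bool) :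
    ((rs.foldl Abs.request (Abs.init k c)).decrement.under &&
      !(rs.foldl Abs.request (Abs.init k c)).bad) = true ↔
    Accepts (annotateRequests rs c) k := by
  obtain ⟨h1, h2⟩ := Abs.foldl_request rs (Abs.init k c) rfl rfl k 0
    (by simp [Abs.Counts, Abs.init, value_encodeNat])
  have h3 : (rs.foldl Abs.request (Abs.init k c)).decrement.Counts k
    (0 + (annotateRequests rs c).countP Choice.granted + 1) := Abs.counts_decrement h2
  have h4 : (rs.foldl Abs.request (Abs.init k c)).decrement.under = true ↔
      k ≤ (annotateRequests rs c).countP Choice.granted := by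
    obtain ⟨h3, h5⟩ := h3
    cases h : (rs.foldl Abs.request (Abs.init k c)).decrement.under
    · have := h5 h
      simp only [Bool.false_eq_true, false_iff]
      omega
    · have := h3 h
      simp only [true_iff]
      omega
  rw [Bool.and_eq_true, h4, Bool.not_eq_true', h1]
  simp only [Abs.init, Accepts, view, List.foldl_nil, List.not_mem_nil, not_false_eq_true,
    implies_true, true_and]
  tauto

end Verifier

namespace Verifier

open StackProg

/-! ### The effect of the program on the code of a query -/

theorem encNat_eq (n : ℕ) : (encNat n).map Sum.inl = bits (encodeNat n) ++ [.inl .comma] := by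
  simp [encNat, bits]

def ofLightpath {G : Network} {m : ℕ} {s t : G.Node} (l : Lightpath G m s t) : Path :=
  (encodeNat l.wavelength.val, l.links.map fun e => encodeNat e.val)

def ofRequest {G : Network} {m : ℕ} (r : Request G m) : List Path × List Path :=
  (r.working.map ofLightpath, r.protection.map ofLightpath)

theorem encLightpath_eq {G : Network} {m : ℕ} {s t : G.Node} (l : Lightpath G m s t) :
    (encLightpath l).map Sum.inl = Abs.pathSymbols (ofLightpath l) := by
  simp only [encLightpath, encList, List.map_append, List.map_cons, List.map_nil, encNat_eq,
    Abs.pathSymbols, ofLightpath, List.map_flatMap, List.flatMap_map, Abs.linkSymbols,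
    List.append_assoc, List.cons_append, List.nil_append]

theorem bra_notMem_encNat (n : ℕ) : (.inl .bra : Sym) ∉ (encNat n).map Sum.inl := by
  simp [encNat]

theorem ket_notMem_encNat (n : ℕ) : Γ'.ket ∉ encNat n := by
  simp [encNat]

theorem read_encRequest {G : Network} {m : ℕ} (r : Request G m) (a : Abs) :
    Abs.read (a.config .request false false) ((encRequest r).map Sum.inl) =
      (a.request (ofRequest r)).config .request false false := by
  rw [← Abs.read_request a ((encNat r.source.val ++ encNat r.target.val).map Sum.inl)]
  · congr 1
    simp only [encRequest, encList, List.map_append, List.map_cons, List.map_nil,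
      ofRequest, List.map_flatMap, List.flatMap_map, encLightpath_eq,
      List.append_assoc, List.cons_append, List.nil_append]
  · rw [List.map_append, List.mem_append, not_or]
    exact ⟨bra_notMem_encNat _, bra_notMem_encNat _⟩

/-- The code of an instance without the last symbol. -/
def encInit (I : Instance) : List Γ' :=
  encNetwork I.network ++ encNat I.numWavelengths ++ .bra :: I.requests.flatMap encRequest

theorem encQuery_eq (I : Instance) (k : ℕ) :
    encQuery (I, k) = encInit I ++ [.ket] ++ encNat k := by
  simp [encQuery, encInstance, encInit, encList]

theorem read_network (a : Abs) (l : List Γ') (h : .ket ∉ l) :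
    Abs.read (a.config .network false false) (l.map Sum.inl) = a.config .network false false := by
  induction l with
  | nil => rfl
  | cons x l ih =>
    simp only [List.mem_cons, not_or] at h
    have e : readSymbol (a.state .network false false) (.inl x) = set id := by
      simp [readSymbol, Abs.state, Ne.symm h.1]
    rw [List.map_cons, Abs.read_cons, Abs.config, e]
    exact ih h.2

theorem read_waves (a : Abs) (l : List Sym) (h : .inl .bra ∉ l) :
    Abs.read (a.config .waves false false) l = a.config .waves false false := by
  induction l with
  | nil => rfl
  | cons x l ih =>
    simp only [List.mem_cons, not_or] at h
    have e : readSymbol (a.state .waves false false) x = set id := by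
      rcases x with x | x
      · have : x ≠ .bra := fun h' => h.1 (by rw [h'])
        simp [readSymbol, Abs.state, this]
      · rfl
    rw [Abs.read_cons, Abs.config, e]
    exact ih h.2

theorem read_encInit (I : Instance) (a : Abs) :
    Abs.read (a.config .network false false) ((encInit I).map Sum.inl) =
      ((I.requests.map ofRequest).foldl Abs.request a).config .request false false := by
  have e : (encInit I).map Sum.inl =
      (encNat I.network.numNodes ++ .bra :: I.network.links.flatMap
        fun e => encNat e.1.val ++ encNat e.2.val).map Sum.inl ++ (.inl .ket ::
      ((encNat I.numWavelengths).map Sum.inl ++ (.inl .bra ::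
        (I.requests.flatMap encRequest).map (Sum.inl : Γ' → Sym)))) := by
    simp [encInit, encNetwork, encList]
  rw [e, Abs.read_append, read_network, Abs.read_cons]
  · have e1 : (readSymbol (a.config .network false false).1 (.inl .ket)).run
      (a.config .network false false) = a.config .waves false false := rfl
    have e2 : (readSymbol (a.config .waves false false).1 (.inl .bra)).run
      (a.config .waves false false) = a.config .request false false := rfl
    rw [e1, Abs.read_append, read_waves _ _ (bra_notMem_encNat _), Abs.read_cons, e2]
    induction I.requests generalizing a with
    | nil => rfl
    | cons r rs ih =>
      rw [List.flatMap_cons, List.map_append, Abs.read_append, read_encRequest, ih _ rfl rfl]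
      rfl
  · simp [ket_notMem_encNat]

def initialState : State where
  mode := .bound
  protection := false
  chosen := false
  someChosen := false
  granted := false
  bad := false
  under := false
  eq := true
  same := false
  hit := false
  borrow := false

theorem run_split (I : Instance) (k : ℕ) (c : List Bool) :
    feed (fun a => choose fun s => splitSymbol s a) (initialState, ({} : Mem).get)
      ((encQuery (I, k)).map Sum.inl ++ c.map Sum.inr).reverse =
    ((Abs.init k c).state .network false false,
      { (Abs.init k c).mem with inp := (encInit I).map Sum.inl }.get) := by
  have h1 : ∀ (c : List Bool) (s : State) (S : Mem),
      feed (fun a => choose fun s => splitSymbol s a) (s, S.get) (c.map Sum.inr) =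
        (s, { S with cert := c.reverse.map Sum.inr ++ S.cert }.get) := by
    intro c
    induction c with
    | nil => intro s S; rfl
    | cons b c ih =>
      intro s S
      rw [List.map_cons, feed_cons]
      have e : splitSymbol s (.inr b) = push .cert (.inr b) := rfl
      simp only [run_choose, e, run_push, Mem.get_cert, Mem.update_cert, ih]
      simp
  have h2 : ∀ (w : Word) (s : State) (S : Mem), s.mode = .bound →
      feed (fun a => choose fun s => splitSymbol s a) (s, S.get) (bits w) =
        (s, { S with num := (bits w).reverse ++ S.num }.get) := by
    intro w
    induction w with
    | nil => intro s S _; rfl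
    | cons b c ih =>
      intro s S hs
      rw [bits_cons, feed_cons]
      have e : splitSymbol s (.inl (.bit b)) = push .num (.inl (.bit b)) := by
        simp [splitSymbol, hs]
      simp only [run_choose, e, run_push, Mem.get_num, Mem.update_num]
      rw [ih _ _ hs]
      simp
  have h3 : ∀ (l : List Γ') (s : State) (S : Mem), s.mode = .network →
      feed (fun a => choose fun s => splitSymbol s a) (s, S.get) (l.map Sum.inl) =
        (s, { S with inp := (l.map Sum.inl).reverse ++ S.inp }.get) := by
    intro l
    induction l with
    | nil => intro s S _; rfl
    | cons b l ih =>
      intro s S hs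
      rw [List.map_cons, feed_cons]
      have e : splitSymbol s (.inl b) = push .inp (.inl b) := by
        simp [splitSymbol, hs]
      simp only [run_choose, e, run_push, Mem.get_inp, Mem.update_inp]
      rw [ih _ _ hs]
      simp
  -- Backwards, the input is the certificate, the comma after `k`, the bits of `k`, the closing
  -- `ket`, and the rest of the instance.
  have e : ((encQuery (I, k)).map Sum.inl ++ c.map Sum.inr).reverse =
      (c.reverse.map Sum.inr ++ ((Sum.inl Γ'.comma : Sym) :: (bits (encodeNat k).reverse ++
        (Sum.inl Γ'.ket : Sym) :: (encInit I).reverse.map Sum.inl))) := by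
    simp only [encQuery_eq, List.map_append, encNat_eq, List.reverse_append, List.map_reverse, bits,
      List.map_cons, List.reverse_cons, List.nil_append, List.append_assoc, List.cons_append]
  rw [e, feed_append, h1, feed_cons]
  have e1 : ∀ (S : Mem), (choose fun s => splitSymbol s (.inl .comma) : Prog).run
    (initialState, S.get) = (initialState, S.get) := fun S => rfl
  have e2 : ∀ (S : Mem), (choose fun s => splitSymbol s (.inl .ket) : Prog).run
    (initialState, S.get) = ((Abs.init k c).state .network false false, S.get) := fun S => rfl
  rw [e1, feed_append, h2 _ _ _ rfl, feed_cons, e2, h3 _ _ _ rfl]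
  simp [Abs.mem, Abs.init, bits, logSymbols]

theorem run_program (I : Instance) (k : ℕ) (c : List Bool) :
    ∃ s, program.run (initialState, Function.update (fun _ => []) .inp
        ((encQuery (I, k)).map Sum.inl ++ c.map Sum.inr)) = (s, fun _ => []) ∧
      ((s.under && !s.bad) = true ↔
        Accepts (annotateRequests (I.requests.map ofRequest) c) k) := by
  rw [← accepts_iff]
  generalize hA : (I.requests.map ofRequest).foldl Abs.request (Abs.init k c) = A
  refine ⟨A.decrement.state .request false false, ?_, Iff.rfl⟩
  have h1 := run_split I k c
  have h2 := read_encInit I (Abs.init k c)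
  rw [hA] at h2
  have h3 : decrement.run (A.config .request false false) =
      (A.decrement.state .request false false, A.decrement.mem.get) := by
    rw [Abs.config, run_decrement A.num _ _ rfl rfl]
    rfl
  rw [Mem.get_empty, Mem.update_inp, program, run_seq, run_move (by decide)]
  simp only [Mem.get_inp, Mem.update_inp, Mem.get_tmp, Mem.update_tmp, List.append_nil]
  rw [run_seq, run_loop]
  simp only [Mem.get_tmp, Mem.update_tmp]
  rw [h1, run_seq, run_loop]
  simp only [Mem.get_inp, Mem.update_inp]
  have h4 : ({ (Abs.init k c).mem with inp := [] } : Mem) = (Abs.init k c).mem := rfl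
  rw [h4]
  change (seq _ _).run (Abs.read ((Abs.init k c).config .network false false) _) = _
  rw [h2, run_seq, h3, run_seq, run_clear, run_seq, run_clear, run_clear]
  simp [Abs.mem]

/-! ### The certificates -/

theorem annotate_map_fst (ls : List Path) : ∀ c, (annotate ls c).map Prod.fst = ls := by
  induction ls with
  | nil => intro c; rfl
  | cons l ls ih => intro c; rw [annotate, List.map_cons, ih]

theorem annotate_bits (l : List (Path × Bool)) (c : List Bool) :
    annotate (l.map Prod.fst) (l.map Prod.snd ++ c) = l := by
  induction l with
  | nil => rfl
  | cons q l ih => simp [annotate, ih]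

namespace Choice

/-- The request without the annotations. -/
def erase (q : Choice) : List Path × List Path := (q.1.map Prod.fst, q.2.map Prod.fst)

def bits (q : Choice) : List Bool := q.1.map Prod.snd ++ q.2.map Prod.snd

end Choice

/-- Every certificate, of whatever length, thus describes a choice of lightpaths of the given
requests. -/
theorem annotateRequests_map_erase (rs : List (List Path × List Path)) :
    ∀ c, (annotateRequests rs c).map Choice.erase = rs := by
  induction rs with
  | nil => intro c; rfl
  | cons r rs ih =>
    intro c
    rw [annotateRequests, List.map_cons, ih]
    simp [Choice.erase, annotate_map_fst]

/-- Conversely, every choice comes from the certificate that lists its bits in reading order. -/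
theorem annotateRequests_bits (qs : List Choice) :
    annotateRequests (qs.map Choice.erase) (qs.flatMap Choice.bits) = qs := by
  induction qs with
  | nil => rfl
  | cons q qs ih =>
    rw [List.map_cons, List.flatMap_cons, annotateRequests]
    simp only [Choice.erase, Choice.bits, List.append_assoc, annotate_bits, List.length_map]
    have h1 : ∀ (l : List (Path × Bool)) (c : List Bool),
        (l.map Prod.snd ++ c).drop l.length = c := fun l c => by
      rw [List.drop_left' (by simp)]
    rw [h1, annotate_bits, h1]
    exact congrArg _ ih

theorem length_flatMap_le {α β : Type} (l : List α) (f : α → ℕ) (g : α → List β)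
    (h : ∀ a, f a ≤ (g a).length) : (l.map f).sum ≤ (l.flatMap g).length := by
  rw [List.length_flatMap]
  exact List.sum_le_sum fun a _ => h a

/-- There is one bit for each lightpath, and the code of a lightpath has at least one symbol. -/
theorem length_bits_le (I : Instance) (k : ℕ) (qs : List Choice)
    (h : qs.map Choice.erase = I.requests.map ofRequest) :
    (qs.flatMap Choice.bits).length ≤ (encQuery (I, k)).length := by
  have h1 : (qs.flatMap Choice.bits).length =
      ((qs.map Choice.erase).map fun r => r.1.length + r.2.length).sum := by
    rw [List.length_flatMap, List.map_map]
    congr 1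
    refine List.map_congr_left fun q _ => ?_
    simp [Choice.bits, Choice.erase]
  rw [h1, h, List.map_map]
  have h2 : ∀ {G : Network} {m : ℕ} {s t : G.Node} (l : List (Lightpath G m s t)),
      l.length ≤ (encList encLightpath l).length := by
    intro G m s t l
    have := length_flatMap_le l (fun _ => 1) encLightpath
      (fun a => by simp [encLightpath, encNat]; omega)
    simp only [List.map_const', List.sum_replicate, smul_eq_mul, mul_one] at this
    simp only [encList, List.length_cons, List.length_append]
    omega
  have h3 := length_flatMap_le I.requests
    ((fun r : List Path × List Path => r.1.length + r.2.length) ∘ ofRequest) encRequest (fun r => by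
      have h4 := h2 r.working
      have h5 := h2 r.protection
      simp only [Function.comp, ofRequest, encRequest, List.length_map, List.length_append]
      omega)
  refine h3.trans ?_
  simp only [encQuery_eq, encInit, List.length_append, List.length_cons]
  omega

end Verifier

namespace Verifier

/-! ### Accepted certificates and feasible solutions -/

theorem exists_annotation {G : Network} {m : ℕ} {s t : G.Node} (ls : List (Lightpath G m s t))
    (l : List (Path × Bool)) (h : l.map Prod.fst = ls.map ofLightpath) :
    ∃ f : Fin ls.length → Bool, l = List.ofFn fun i => (ofLightpath (ls.get i), f i) := by
  have hl : l.length = ls.length := by simpa using congrArg List.length h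
  refine ⟨fun i => (l.get (i.cast hl.symm)).2, ?_⟩
  refine List.ext_getElem (by simp [hl]) fun i h1 h2 => ?_
  have : (l.map Prod.fst)[i]'(by simpa using h1) = (ls.map ofLightpath)[i]'(by simpa [← hl]) := by
    simp only [h]
  simp only [List.getElem_map] at this
  simp [← this]

variable (I : Instance)

/-- The requests of an instance, annotated by a choice of lightpaths. -/
def choices (X : (r : I.R) → I.W r → Bool) (Y : (r : I.R) → I.P r → Bool) : List Choice :=
  List.ofFn fun r : I.R => (List.ofFn fun w => (ofLightpath (I.workingPath w), X r w),
    List.ofFn fun p => (ofLightpath (I.protectionPath p), Y r p))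

theorem exists_choices (qs : List Choice)
    (h : qs.map Choice.erase = I.requests.map ofRequest) : ∃ X Y, qs = choices I X Y := by
  have hl : qs.length = I.requests.length := by simpa using congrArg List.length h
  have key : ∀ r : I.R, (qs.get (r.cast hl.symm)).erase = ofRequest (I.request r) := by
    intro r
    have : (qs.map Choice.erase)[r.val]'(by simp [hl]) =
      (I.requests.map ofRequest)[r.val]'(by simp) := by simp only [h]
    simp only [List.getElem_map] at this
    exact this
  choose X hX using fun r => exists_annotation _ _ (congrArg Prod.fst (key r))
  choose Y hY using fun r => exists_annotation _ _ (congrArg Prod.snd (key r))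
  refine ⟨X, Y, ?_⟩
  refine List.ext_getElem (by simp [hl, choices]) fun i h1 h2 => ?_
  simp only [choices, List.getElem_ofFn]
  exact Prod.ext (hX ⟨i, hl ▸ h1⟩) (hY ⟨i, hl ▸ h1⟩)

theorem erase_choices (X : (r : I.R) → I.W r → Bool) (Y : (r : I.R) → I.P r → Bool) :
    (choices I X Y).map Choice.erase = I.requests.map ofRequest := by
  refine List.ext_getElem (by simp [choices]) fun i h1 h2 => ?_
  simp only [choices, List.getElem_map, List.getElem_ofFn, Choice.erase, ofRequest]
  refine Prod.ext ?_ ?_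
  · exact List.ext_getElem (by simp; rfl) fun j _ _ => by simp; rfl
  · exact List.ext_getElem (by simp; rfl) fun j _ _ => by simp; rfl

theorem countP_ofFn {α : Type} {n : ℕ} (p : α → Bool) (f : Fin n → α) :
    (List.ofFn f).countP p = ∑ i, (p (f i)).toNat := by
  induction n with
  | zero => simp
  | succ n ih =>
    rw [List.ofFn_succ, List.countP_cons, ih, Fin.sum_univ_succ, add_comm]
    cases p (f 0) <;> simp

theorem encodeNat_injective : Function.Injective encodeNat := fun a b h => by
  rw [← decode_encodeNat a, h, decode_encodeNat]

theorem mem_chosenItems_ofFn {G : Network} {m : ℕ} {s t : G.Node} {n : ℕ}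
    (l : Fin n → Lightpath G m s t) (f : Fin n → Bool) (i : Item) :
    i ∈ chosenItems (List.ofFn fun j => (ofLightpath (l j), f j)) ↔
      ∃ j, f j = true ∧ ∃ e ∈ (l j).linkSet,
        i = (some (encodeNat (l j).wavelength.val), encodeNat e.val) := by
  simp only [chosenItems, List.mem_flatMap, List.mem_ofFn]
  constructor
  · rintro ⟨_, ⟨j, rfl⟩, hi⟩
    simp only at hi
    split_ifs at hi with hj
    · obtain ⟨w, hw, rfl⟩ := List.mem_map.1 hi
      obtain ⟨e, he, rfl⟩ := List.mem_map.1 hw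
      exact ⟨j, hj, e, List.mem_toFinset.2 he, rfl⟩
    · simp at hi
  · rintro ⟨j, hj, e, he, rfl⟩
    refine ⟨_, ⟨j, rfl⟩, ?_⟩
    simp only [hj, if_true]
    exact List.mem_map_of_mem (List.mem_map_of_mem (List.mem_toFinset.1 he))

theorem nodup_links {G : Network} {m : ℕ} {s t : G.Node} (l : Lightpath G m s t) :
    l.links.Nodup :=
  List.Nodup.of_map _ (List.nodup_cons.1 l.isPath.2).2

/-- A single chosen simple path repeats no link. So the `Nodup` condition in `Choice.Valid` only
forbids a link common to the working and the protection lightpath. -/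
theorem nodup_chosenItems (l : List (Path × Bool)) (h : l.countP Prod.snd ≤ 1)
    (h' : ∀ q ∈ l, q.1.2.Nodup) : ((chosenItems l).map Prod.snd).Nodup := by
  induction l with
  | nil => simp [chosenItems]
  | cons q l ih =>
    rw [List.countP_cons] at h
    simp only [List.forall_mem_cons] at h'
    rw [chosenItems, List.flatMap_cons, ← chosenItems]
    split_ifs with hq
    · have : chosenItems l = [] := by
        rw [if_pos hq] at h
        have h0 : l.countP Prod.snd = 0 := by omega
        rw [List.countP_eq_zero] at h0
        rw [chosenItems, List.flatMap_eq_nil_iff]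
        intro q hq
        rw [if_neg (h0 q hq)]
      rw [this, List.append_nil, List.map_map]
      simpa [Function.comp_def] using h'.1
    · exact ih (by omega) h'.2

theorem le_one_of_not_both {a b : Bool} (h : ¬(a = true ∧ b = true)) :
    a.toNat + b.toNat ≤ 1 := by
  cases a <;> cases b <;> simp at h ⊢

/-- Validity of single requests gives the sum constraints and `C₁`; disjointness of the items of
distinct requests gives `C₂`, `C₃` and `C₄`, since a common item is a common link on a common
wavelength. -/
theorem accepts_choices_iff (X : (r : I.R) → I.W r → Bool) (Y : (r : I.R) → I.P r → Bool)
    (k : ℕ) : Accepts (choices I X Y) k ↔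
      I.Feasible (fun r w => (X r w).toNat) (fun r p => (Y r p).toNat) ∧
        k ≤ I.granted (fun r w => (X r w).toNat) := by
  let q : I.R → Choice := fun r =>
    (List.ofFn fun w => (ofLightpath (I.workingPath w), X r w),
      List.ofFn fun p => (ofLightpath (I.protectionPath p), Y r p))
  have hq : choices I X Y = List.ofFn q := rfl
  have hX : ∀ r, (q r).1.countP Prod.snd = ∑ w, (X r w).toNat := fun r => countP_ofFn _ _
  have hY : ∀ r, (q r).2.countP Prod.snd = ∑ p, (Y r p).toNat := fun r => countP_ofFn _ _
  have hitemX : ∀ r w, X r w = true → ∀ e ∈ (I.workingPath w).linkSet,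
      (some (encodeNat (I.workingPath w).wavelength.val), encodeNat e.val) ∈
        chosenItems (q r).1 := fun r w h e he =>
    (mem_chosenItems_ofFn _ _ _).2 ⟨w, h, e, he, rfl⟩
  have hitemY : ∀ r p, Y r p = true → ∀ e ∈ (I.protectionPath p).linkSet,
      (some (encodeNat (I.protectionPath p).wavelength.val), encodeNat e.val) ∈
        chosenItems (q r).2 := fun r p h e he =>
    (mem_chosenItems_ofFn _ _ _).2 ⟨p, h, e, he, rfl⟩
  -- The verifier counts chosen protection lightpaths, the objective counts working ones; validity
  -- makes them agree.
  have hgranted : (∀ r, (q r).Valid) →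
      (List.ofFn q).countP Choice.granted = I.granted fun r w => (X r w).toNat := by
    intro h
    rw [countP_ofFn, Instance.granted]
    refine Finset.sum_congr rfl fun r _ => ?_
    rw [← hX, (h r).1]
    exact toNat_any _ ((h r).1 ▸ (h r).2.1)
  rw [Accepts, hq, List.pairwise_ofFn]
  simp only [List.forall_mem_ofFn_iff]
  constructor
  · rintro ⟨h1, h2, h3⟩
    rw [hgranted h1] at h3
    -- Disjointness is symmetric, so the ordered pairs of `Pairwise` cover all distinct requests.
    have hne : ∀ r r', r ≠ r' → ∀ i ∈ (q r).items, i ∉ (q r').items := by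
      intro r r' hr i hi hi'
      rcases lt_or_gt_of_ne hr with h | h
      · exact h2 h i hi' hi
      · exact h2 h i hi hi'
    refine ⟨⟨fun r => ?_, fun r => ?_, ?_, ?_, ?_, ?_, ?_, ?_⟩, h3⟩
    · rw [← hX, ← hY]
      exact (h1 r).1
    · rw [← hX]
      exact (h1 r).2.1
    · rintro r w p ⟨e, he⟩
      rw [Finset.mem_inter] at he
      refine le_one_of_not_both fun ⟨hx, hy⟩ => ?_
      have := (h1 r).2.2
      rw [Choice.items, List.map_append, List.nodup_append] at this
      exact this.2.2 _ (List.mem_map_of_mem (f := Prod.snd) (hitemX r w hx e he.1)) _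
        (List.mem_map_of_mem (f := Prod.snd) (hitemY r p hy e he.2)) rfl
    · rintro r r' w p ⟨hr, hw, e, he⟩
      rw [Finset.mem_inter] at he
      refine le_one_of_not_both fun ⟨hx, hy⟩ => ?_
      refine hne r r' hr _ (List.mem_append_left _ (hitemX r w hx e he.1)) ?_
      simp only at hw
      rw [hw]
      exact List.mem_append_right _ (hitemY r' p hy e he.2)
    · rintro r r' w w' ⟨hr, hw, e, he⟩
      rw [Finset.mem_inter] at he
      refine le_one_of_not_both fun ⟨hx, hy⟩ => ?_
      refine hne r r' hr _ (List.mem_append_left _ (hitemX r w hx e he.1)) ?_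
      simp only at hw
      rw [hw]
      exact List.mem_append_left _ (hitemX r' w' hy e he.2)
    · rintro r r' p p' ⟨hr, hw, e, he⟩
      rw [Finset.mem_inter] at he
      refine le_one_of_not_both fun ⟨hx, hy⟩ => ?_
      refine hne r r' hr _ (List.mem_append_right _ (hitemY r p hx e he.1)) ?_
      simp only at hw
      rw [hw]
      exact List.mem_append_right _ (hitemY r' p' hy e he.2)
    · intro r w
      cases X r w <;> simp
    · intro r p
      cases Y r p <;> simp
  · rintro ⟨h, hk⟩
    have hlink : ∀ {e e' : I.network.Link}, encodeNat e.val = encodeNat e'.val → e = e' :=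
      fun h => Fin.ext (encodeNat_injective h)
    have hwave : ∀ {e e' : Fin I.numWavelengths},
        some (encodeNat e.val) = some (encodeNat e'.val) → e = e' :=
      fun h => Fin.ext (encodeNat_injective (Option.some_injective _ h))
    have hvalid : ∀ r, (q r).Valid := by
      intro r
      have h1 : (q r).1.countP Prod.snd = (q r).2.countP Prod.snd := by
        rw [hX, hY]
        exact h.balanced r
      have h2 : (q r).1.countP Prod.snd ≤ 1 := by
        rw [hX]
        exact h.at_most_one r
      refine ⟨h1, h2, ?_⟩
      rw [Choice.items, List.map_append, List.nodup_append]
      refine ⟨nodup_chosenItems _ h2 ?_, nodup_chosenItems _ (h1 ▸ h2) ?_, ?_⟩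
      · rintro _ hp
        obtain ⟨w, rfl⟩ := List.mem_ofFn.1 hp
        exact (nodup_links _).map fun _ _ => hlink
      · rintro _ hp
        obtain ⟨w, rfl⟩ := List.mem_ofFn.1 hp
        exact (nodup_links _).map fun _ _ => hlink
      · rintro _ ha _ hb rfl
        obtain ⟨i, hi, hi'⟩ := List.mem_map.1 ha
        obtain ⟨j, hj, hj'⟩ := List.mem_map.1 hb
        obtain ⟨w, hx, e, he, rfl⟩ := (mem_chosenItems_ofFn _ _ _).1 hi
        obtain ⟨p, hy, e', he', rfl⟩ := (mem_chosenItems_ofFn _ _ _).1 hj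
        obtain rfl : e = e' := hlink (hi'.trans hj'.symm)
        have := h.conflict₁ r w p ⟨e, Finset.mem_inter.2 ⟨he, he'⟩⟩
        simp [hx, hy] at this
    refine ⟨hvalid, ?_, by rw [hgranted hvalid]; exact hk⟩
    intro r' r hlt i hi hi'
    have hr : r' ≠ r := hlt.ne
    -- Each of the two lightpaths sharing an item is a working or a protection one, giving a
    -- conflict in `C₃`, `C₂`, `C₂` or `C₄`.
    rcases List.mem_append.1 hi with hi | hi <;> rcases List.mem_append.1 hi' with hi' | hi' <;>
      obtain ⟨w, hx, e, he, rfl⟩ := (mem_chosenItems_ofFn _ _ _).1 hi <;>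
      obtain ⟨p, hy, e', he', hee⟩ := (mem_chosenItems_ofFn _ _ _).1 hi' <;>
      obtain ⟨h1, h2⟩ := Prod.ext_iff.1 hee <;>
      have hw := hwave h1 <;>
      obtain rfl : e = e' := hlink h2
    · have := h.conflict₃ r' r p w ⟨hr, hw.symm, e, Finset.mem_inter.2 ⟨he', he⟩⟩
      simp [hx, hy] at this
    · have := h.conflict₂ r r' w p ⟨hr.symm, hw, e, Finset.mem_inter.2 ⟨he, he'⟩⟩
      simp [hx, hy] at this
    · have := h.conflict₂ r' r p w ⟨hr, hw.symm, e, Finset.mem_inter.2 ⟨he', he⟩⟩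
      simp [hx, hy] at this
    · have := h.conflict₄ r' r p w ⟨hr, hw.symm, e, Finset.mem_inter.2 ⟨he', he⟩⟩
      simp [hx, hy] at this

/-- The verifier: its certificate tells for each lightpath whether it is chosen. -/
noncomputable def verify (x : (Instance × ℕ) × List Bool) : Bool :=
  open Classical in
  decide (Accepts (annotateRequests (x.1.1.requests.map ofRequest) x.2) x.1.2)

theorem canGrant_iff (k : ℕ) : I.CanGrant k ↔
    ∃ c : List Bool, c.length ≤ (encQuery (I, k)).length ∧ verify ((I, k), c) = true := by
  simp only [verify, decide_eq_true_eq]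
  constructor
  · rintro ⟨x, y, h, hk⟩
    have hx : (fun r w => (decide (x r w = 1)).toNat) = x := by
      funext r w
      rcases h.binary_x r w with h | h <;> simp [h]
    have hy : (fun r p => (decide (y r p = 1)).toNat) = y := by
      funext r p
      rcases h.binary_y r p with h | h <;> simp [h]
    have he := erase_choices I (fun r w => decide (x r w = 1)) (fun r p => decide (y r p = 1))
    refine ⟨_, length_bits_le I k _ he, ?_⟩
    rw [← he, annotateRequests_bits, accepts_choices_iff, hx, hy]
    exact ⟨h, hk⟩
  · rintro ⟨c, -, h⟩
    obtain ⟨X, Y, he⟩ := exists_choices I _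
      (annotateRequests_map_erase (I.requests.map ofRequest) c)
    rw [he, accepts_choices_iff] at h
    exact ⟨_, _, h⟩

end Verifier

theorem lemma1 : InNP queryEncoding (fun q : Instance × ℕ => q.1.CanGrant q.2) := by
  refine ⟨Polynomial.X, Verifier.verify, ?_, fun q => ?_⟩
  -- The encoding of pairs tags the symbols of its two components, which is why the machine's
  -- alphabet is `Sym`.
  · refine StackProg.exists_computableInPolyTime Verifier.program Verifier.bounded_program .inp
      Verifier.initialState (fun s => s.under && !s.bad) _ _ fun x => ?_
    obtain ⟨s, h1, h2⟩ := Verifier.run_program x.1.1 x.1.2 x.2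
    refine ⟨s, h1, ?_⟩
    rw [Bool.eq_iff_iff, h2]
    simp [Verifier.verify]
  · rw [Polynomial.eval_X]
    exact Verifier.canGrant_iff q.1 q.2
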